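/- **Model.** Let $p\ge 2$, $N\ge p$ and $\beta>0$. For $\sigma\in\{-1,1\}^N$ and $\mathcal C\subset\{1,\dots,N\}$ with $|\mathcal C|=p$ put $H_{N,p}(\sigma,\mathcal C)=-\frac1{2p}\sum_{j,k\in\mathcal C}\sigma_j\sigma_k$. Consider the Markov chain $(\sigma^p(n))_{n\ge0}$ on $\{-1,1\}^N$ in which, at each step, a site $i$ is chosen uniformly, then a set $\mathcal C\ni i$ of size $p$ is chosen uniformly among such sets, and the spin $i$ is reversed (giving $\sigma'$) with probability $\exp\big(-\beta\,(H_{N,p}(\sigma',\mathcal C)-H_{N,p}(\sigma^p(n),\mathcal C))_+\big)$; otherwise the configuration is kept. Let $m_{N,p}(n)=\frac1N\sum_{i}\sigma^p_i(n)$. Define $$S_1^{p,\beta}(m)=\sum_{k=0}^{p-1}\binom{p-1}{k}\Big(\frac{1-m}2\Big)^k\Big(\frac{1+m}2\Big)^{p-1-k}e^{-2\beta\left(\frac{2k+1-p}{p}\right)_+},$$ $$S_2^{p,\beta}(m)=\sum_{k=0}^{p-1}\binom{p-1}{k}\Big(\frac{1-m}2\Big)^k\Big(\frac{1+m}2\Big)^{p-1-k}e^{-2\beta\left(\frac{p-1-2k}{p}\right)_+},$$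 $$f_p(\beta,m)=\big(S_1^{p,\beta}(m)-S_2^{p,\beta}(m)\big)-m\big(S_1^{p,\beta}(m)+S_2^{p,\beta}(m)\big).$$ For the equilibrium $0$ of an ODE $\dot m=F(m)$: it is *linearly stable* if $F'(0)\le 0$, *asymptotically stable* if it is Lyapunov stable and locally attractive, and *unstable* if it is not Lyapunov stable. **Theorem.** 1. Let $p\ge2$ and $\beta>0$. For every $x\in[-1,1]$ the ODE $\frac{d}{dt}m(t)=f_p(\beta,m(t))$, $m(0)=x$, has a unique solution on $[0,\infty)$, and it stays in $[-1,1]$. If $m_{N,p}(0)$ converges in distribution, as $N\to\infty$, to a random variable $Z$, then the process $M^{(N,p)}_t=m_{N,p}(\lfloor Nt\rfloor)$, $t\ge0$, converges in distribution, in the Skorokhod space $D([0,\infty),\mathbb R)$ with the $J_1$ topology, to the solution of this ODE with initial value $Z$. Moreover $0$ is an equilibrium: $f_p(\beta,0)=0$. 2. Let $p\in\{2,3\}$. For every $\beta>0$, $0$ is the unique equilibrium in $[-1,1]$, $\partial_mf_p(\beta,0)<0$, and $0$ is linearly and asymptotically stable. 3. There are numbers $\beta_{c,p}>0$, $p\ge4$,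 such that for every $p\ge4$ and $\beta>0$: if $\beta\le\beta_{c,p}$ then $0$ is linearly stable; if $\beta<\beta_{c,p}$ then $\partial_mf_p(\beta,0)<0$ and $0$ is asymptotically stable; if $\beta>\beta_{c,p}$ then $\partial_mf_p(\beta,0)>0$ and $0$ is unstable. Furthermore, as $p\to\infty$, $$\beta_{c,p}=1+\sqrt{\frac{2}{p\pi}}+o\Big(\frac1{\sqrt p}\Big).$$ -/

import Mathlib

open Set Filter MeasureTheory Asymptotics
open scoped NNReal Topology

noncomputable section

/-! ### The spin chain with random batches -/

/-- Configurations of `N` spins; each spin is a unit of `ℤ`, that is `1` or `-1`. -/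
abbrev SpinConfig (N : ℕ) : Type := Fin N → ℤˣ

/-- The real number `1` or `-1` carried by site `i`. -/
def spinVal {N : ℕ} (s : SpinConfig N) (i : Fin N) : ℝ := ((s i : ℤ) : ℝ)

/-- The configuration in which the spin at site `i` has been reversed. -/
def flipSpin {N : ℕ} (s : SpinConfig N) (i : Fin N) : SpinConfig N :=
  Function.update s i (-s i)

/-- The mean magnetization `(1/N) ∑ i, s i`. -/
def magnetization {N : ℕ} (s : SpinConfig N) : ℝ := (∑ i, spinVal s i) / N

/-- The energy of a configuration restricted to a batch `C`, for batches of size `p`. -/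
def batchEnergy {N : ℕ} (p : ℕ) (s : SpinConfig N) (C : Finset (Fin N)) : ℝ :=
  -(1 / (2 * (p : ℝ))) * ∑ j ∈ C, ∑ k ∈ C, spinVal s j * spinVal s k

/-- The batches of size `p` that contain the site `i`. -/
def batchesAt (N p : ℕ) (i : Fin N) : Finset (Finset (Fin N)) :=
  Finset.univ.filter fun C => i ∈ C ∧ C.card = p

/-- The probability that the reversal of spin `i` is accepted, given the batch `C`. -/
def acceptProb {N : ℕ} (p : ℕ) (β : ℝ) (s : SpinConfig N) (i : Fin N) (C : Finset (Fin N)) : ℝ :=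
  Real.exp (-β * max (batchEnergy p (flipSpin s i) C - batchEnergy p s C) 0)

/-- One step of the dynamics: choose a site uniformly, then a batch of size `p` uniformly among
those containing the site, then reverse the spin with the acceptance probability. This is the
probability to go from `s` to `s'` (meaningful for `1 ≤ p ≤ N`). -/
def rbTransition {N : ℕ} (p : ℕ) (β : ℝ) (s s' : SpinConfig N) : ℝ :=
  ∑ i : Fin N, (1 / (N : ℝ)) * ∑ C ∈ batchesAt N p i, (1 / ((batchesAt N p i).card : ℝ)) *
    (acceptProb p β s i C * (if s' = flipSpin s i then 1 else 0)
      + (1 - acceptProb p β s i C) * (if s' = s then 1 else 0))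

/-- The process `σ` is a (time-homogeneous) Markov chain under `P`, with the transition
probabilities of the random batch dynamics and an arbitrary initial law. -/
def IsRandomBatchChain {N : ℕ} (p : ℕ) (β : ℝ) {Ω : Type*} [MeasurableSpace Ω] (P : Measure Ω)
    (σ : ℕ → Ω → SpinConfig N) : Prop :=
  ∀ (n : ℕ) (s : ℕ → SpinConfig N),
    P.real {ω | ∀ k ≤ n + 1, σ k ω = s k}
      = P.real {ω | ∀ k ≤ n, σ k ω = s k} * rbTransition p β (s n) (s (n + 1))

/-! ### The limiting vector field -/

def rbS1 (p : ℕ) (β m : ℝ) : ℝ :=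
  ∑ k ∈ Finset.range p, ((p - 1).choose k : ℝ) * ((1 - m) / 2) ^ k * ((1 + m) / 2) ^ (p - 1 - k)
    * Real.exp (-2 * β * max ((2 * (k : ℝ) + 1 - p) / p) 0)

def rbS2 (p : ℕ) (β m : ℝ) : ℝ :=
  ∑ k ∈ Finset.range p, ((p - 1).choose k : ℝ) * ((1 - m) / 2) ^ k * ((1 + m) / 2) ^ (p - 1 - k)
    * Real.exp (-2 * β * max (((p : ℝ) - 1 - 2 * (k : ℝ)) / p) 0)

/-- The function `f_p(β, m)`. -/
def rbDrift (p : ℕ) (β m : ℝ) : ℝ :=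
  (rbS1 p β m - rbS2 p β m) - m * (rbS1 p β m + rbS2 p β m)

/-! ### Autonomous scalar differential equations on `[0, ∞)` -/

/-- `x : [0, ∞) → ℝ` solves `x' = F(x)` (with a one-sided derivative at time `0`). -/
def SolvesODE (F : ℝ → ℝ) (x : ℝ≥0 → ℝ) : Prop :=
  ∀ t : ℝ≥0, HasDerivWithinAt (fun s : ℝ => x s.toNNReal) (F (x t)) (Ici 0) (t : ℝ)

def IsEquilibrium (F : ℝ → ℝ) (c : ℝ) : Prop := F c = 0

/-- Linear stability of an equilibrium: `F'(c) ≤ 0`. -/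
def IsLinearlyStable (F : ℝ → ℝ) (c : ℝ) : Prop :=
  IsEquilibrium F c ∧ DifferentiableAt ℝ F c ∧ deriv F c ≤ 0

/-- Stability in the sense of Lyapunov. -/
def IsLyapunovStable (F : ℝ → ℝ) (c : ℝ) : Prop :=
  ∀ ε > 0, ∃ δ > 0, ∀ x : ℝ≥0 → ℝ, SolvesODE F x → |x 0 - c| < δ → ∀ t, |x t - c| < ε

/-- Asymptotic stability: Lyapunov stable and locally attractive. -/
def IsAsymptoticallyStable (F : ℝ → ℝ) (c : ℝ) : Prop :=
  IsLyapunovStable F c ∧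
    ∃ δ > 0, ∀ x : ℝ≥0 → ℝ, SolvesODE F x → |x 0 - c| < δ → Tendsto x atTop (𝓝 c)

/-- An equilibrium is unstable if it is not stable in the sense of Lyapunov. -/
def IsUnstable (F : ℝ → ℝ) (c : ℝ) : Prop := ¬ IsLyapunovStable F c

/-! ### The Skorokhod space `D([0, ∞), ℝ)` -/

/-- Right-continuous with left limits at every time. -/
def IsCadlagFun (x : ℝ≥0 → ℝ) : Prop :=
  ∀ t, ContinuousWithinAt x (Ici t) t ∧ ∃ l, Tendsto x (𝓝[<] t) (𝓝 l)

/-- The space of càdlàg paths `[0, ∞) → ℝ`. -/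
structure SkorokhodPath where
  toFun : ℝ≥0 → ℝ
  cadlag : IsCadlagFun toFun

instance : CoeFun SkorokhodPath (fun _ => ℝ≥0 → ℝ) := ⟨SkorokhodPath.toFun⟩

/-- The basic Skorokhod (J1) neighbourhood of the path `x`: all paths `y` that are `ε`-close
to `x` up to time `T`, after an increasing change of time that is `ε`-close to the identity
up to time `T`. -/
def SkorokhodPath.nbhd (x : SkorokhodPath) (T : ℝ≥0) (ε : ℝ) : Set SkorokhodPath :=
  {y | ∃ lam : ℝ≥0 ≃o ℝ≥0, ∀ t ≤ T, |(lam t : ℝ) - (t : ℝ)| < ε ∧ |y t - x (lam t)| < ε}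

theorem SkorokhodPath.nbhd_mono (x : SkorokhodPath) {T T' : ℝ≥0} {ε ε' : ℝ} (hT : T' ≤ T)
    (hε : ε ≤ ε') : x.nbhd T ε ⊆ x.nbhd T' ε' := by
  rintro y ⟨lam, h⟩
  exact ⟨lam, fun t ht => ⟨(h t (ht.trans hT)).1.trans_le hε, (h t (ht.trans hT)).2.trans_le hε⟩⟩

/-- Skorokhod's J1 topology on `D([0, ∞), ℝ)`. -/
instance : TopologicalSpace SkorokhodPath where
  IsOpen U := ∀ x ∈ U, ∃ T : ℝ≥0, ∃ ε > 0, x.nbhd T ε ⊆ U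
  isOpen_univ := fun _ _ => ⟨0, 1, one_pos, subset_univ _⟩
  isOpen_inter := by
    rintro U V hU hV x ⟨hxU, hxV⟩
    obtain ⟨T, ε, hε, h⟩ := hU x hxU
    obtain ⟨T', ε', hε', h'⟩ := hV x hxV
    exact ⟨max T T', min ε ε', lt_min hε hε', subset_inter
      ((x.nbhd_mono (le_max_left _ _) (min_le_left _ _)).trans h)
      ((x.nbhd_mono (le_max_right _ _) (min_le_right _ _)).trans h')⟩
  isOpen_sUnion := by
    rintro S hS x ⟨U, hU, hxU⟩
    obtain ⟨T, ε, hε, h⟩ := hS U hU x hxU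
    exact ⟨T, ε, hε, h.trans (subset_sUnion_of_mem hU)⟩

instance : MeasurableSpace SkorokhodPath := borel SkorokhodPath

instance : BorelSpace SkorokhodPath := ⟨rfl⟩

/-- A sequence, read as a step function of the rescaled time, is càdlàg. -/
theorem isCadlagFun_rescaled (N : ℕ) (a : ℕ → ℝ) :
    IsCadlagFun fun t : ℝ≥0 => a ⌊(N : ℝ≥0) * t⌋₊ := by
  have hcont : Continuous fun s : ℝ≥0 => (N : ℝ≥0) * s := by fun_prop
  intro t
  constructor
  · refine (tendsto_const_nhds (x := a ⌊(N : ℝ≥0) * t⌋₊)).congr' ?_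
    have h1 : ∀ᶠ s in 𝓝[≥] t, (N : ℝ≥0) * s < (⌊(N : ℝ≥0) * t⌋₊ : ℝ≥0) + 1 :=
      nhdsWithin_le_nhds (hcont.continuousAt.eventually_lt continuousAt_const
        (Nat.lt_floor_add_one _))
    filter_upwards [h1, self_mem_nhdsWithin] with s hs hts
    congr 1
    symm
    rw [Nat.floor_eq_iff (zero_le)]
    exact ⟨(Nat.floor_le zero_le).trans (mul_le_mul_right hts _), hs⟩
  · rcases Nat.eq_zero_or_pos N with rfl | hN
    · exact ⟨a 0, by simpa using tendsto_const_nhds⟩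
    refine ⟨a (⌈(N : ℝ≥0) * t⌉₊ - 1), (tendsto_const_nhds).congr' ?_⟩
    rcases eq_or_ne t 0 with rfl | ht
    · have : (𝓝[<] (0 : ℝ≥0)) = ⊥ := by simp
      rw [this]; exact Filter.eventually_bot
    have hpos : 0 < (N : ℝ≥0) * t := by positivity
    have hc : 0 < ⌈(N : ℝ≥0) * t⌉₊ := Nat.ceil_pos.2 hpos
    have hlt : ((⌈(N : ℝ≥0) * t⌉₊ - 1 : ℕ) : ℝ≥0) < (N : ℝ≥0) * t :=
      Nat.lt_ceil.1 (by omega)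
    have h1 : ∀ᶠ s in 𝓝[<] t, ((⌈(N : ℝ≥0) * t⌉₊ - 1 : ℕ) : ℝ≥0) < (N : ℝ≥0) * s :=
      nhdsWithin_le_nhds (continuousAt_const.eventually_lt hcont.continuousAt hlt)
    filter_upwards [h1, self_mem_nhdsWithin] with s hs hts
    congr 1
    symm
    rw [Nat.floor_eq_iff zero_le]
    refine ⟨hs.le, ?_⟩
    have h2 : (N : ℝ≥0) * s < (N : ℝ≥0) * t :=
      mul_lt_mul_of_pos_left hts (by exact_mod_cast hN)
    refine h2.trans_le ((Nat.le_ceil _).trans ?_)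
    have : ⌈(N : ℝ≥0) * t⌉₊ = (⌈(N : ℝ≥0) * t⌉₊ - 1) + 1 := by omega
    exact_mod_cast this.le

/-- The path `t ↦ a ⌊N t⌋` in `D([0, ∞), ℝ)`. -/
def rescaledPath (N : ℕ) (a : ℕ → ℝ) : SkorokhodPath :=
  ⟨fun t => a ⌊(N : ℝ≥0) * t⌋₊, isCadlagFun_rescaled N a⟩

end

/-! Convergence. The other `p - 1` members of a batch are drawn without replacement, so their number
of minus spins is hypergeometric, within `O(1/N)` of binomial with parameter `(1 - m)/2`. Hence the
mean one-step increment of the magnetization is `f_p(β, m)/N + O(1/N²)`, while each increment is at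
most `2/N`. Compare the chain with the ODE solution started at the chain's own random initial
magnetization. With `K` a Lipschitz constant of the drift, the mean squared distance satisfies `u
(n+1) ≤ (1 + 2K/N) u n + C/N²`, so discrete Gronwall gives `O(1/N)` for `n ≤ N T`. Both paths have
bounded speed, so Chebyshev on a time grid whose size does not depend on `N` already gives uniform
closeness on `[0, T]`; no maximal inequality is needed. The solution map `Φ` from initial values to
paths is continuous, so `Φ` of the initial magnetization converges in law to `Φ Z`, and the
closeness in probability carries this limit over to the chain.

Stability. Let `n = p - 1`, let `X` be a sum of `n` independent fair signs and `c = 2β/p`. By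
symmetry of `X`, the derivative of the drift at `0` is `2 E[X₊ (1 - exp(-c X₊)) - exp(-c X₊)]`. It
is strictly increasing in `β`, equals `-2` at `β = 0`, and tends to `2 (E X₊ - P(X ≤ 0))` as `β →
∞`. This limit is positive for `n ≥ 3`, which gives exactly one zero, the critical value. For `p =
2, 3` the drift is an explicit polynomial in `m`. A nonzero derivative decides stability through the
monotone quantity `x² exp(±2lt)`.

Asymptotics. Put `s = 1/√p` and `β = 1 + b s`, and expand the exponentials. With `E X₊² = n/2`, `E
X₊ ~ √(n/(2π))` (Wallis) and `E X₊³ ~ 2n E X₊`, the expectation above equals `s (b - √(2/π) +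
o(1))`. Monotonicity in `β` then traps the root. -/

noncomputable section

/-! ### Symmetric binomial sums -/

/-- The sum `∑ k, C(n, k) g (n - 2 k)`. -/
def binomSum (n : ℕ) (g : ℝ → ℝ) : ℝ :=
  ∑ k ∈ Finset.range (n + 1), (n.choose k : ℝ) * g ((n : ℝ) - 2 * k)

theorem binomSum_add (n : ℕ) (g h : ℝ → ℝ) :
    binomSum n (fun x => g x + h x) = binomSum n g + binomSum n h := by
  simp only [binomSum, mul_add, Finset.sum_add_distrib]

theorem binomSum_sub (n : ℕ) (g h : ℝ → ℝ) :
    binomSum n (fun x => g x - h x) = binomSum n g - binomSum n h := by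
  simp only [binomSum, mul_sub, Finset.sum_sub_distrib]

theorem binomSum_const_mul (n : ℕ) (c : ℝ) (g : ℝ → ℝ) :
    binomSum n (fun x => c * g x) = c * binomSum n g := by
  simp only [binomSum, Finset.mul_sum]
  exact Finset.sum_congr rfl fun _ _ => by ring

theorem binomSum_mono (n : ℕ) {g h : ℝ → ℝ} (H : ∀ x, g x ≤ h x) :
    binomSum n g ≤ binomSum n h :=
  Finset.sum_le_sum fun _ _ => mul_le_mul_of_nonneg_left (H _) (Nat.cast_nonneg _)

theorem binomSum_neg (n : ℕ) (g : ℝ → ℝ) :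
    binomSum n (fun x => g (-x)) = binomSum n g := by
  unfold binomSum
  rw [← Finset.sum_range_reflect]
  refine Finset.sum_congr rfl fun k hk => ?_
  have hk' : k ≤ n := Nat.lt_succ_iff.1 (Finset.mem_range.1 hk)
  simp only [Nat.add_sub_cancel, Nat.choose_symm hk', Nat.cast_sub hk']
  congr 2
  ring

theorem binomSum_one (n : ℕ) : binomSum n (fun _ => 1) = 2 ^ n := by
  simp only [binomSum, mul_one]
  exact_mod_cast Nat.sum_range_choose n

theorem binomSum_succ (n : ℕ) (g : ℝ → ℝ) :
    binomSum (n + 1) g = binomSum n (fun x => g (x + 1)) + binomSum n (fun x => g (x - 1)) := by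
  unfold binomSum
  rw [Finset.sum_range_succ' _ (n + 1)]
  simp only [Nat.choose_succ_succ, Nat.cast_add, add_mul, Finset.sum_add_distrib]
  rw [Finset.sum_range_succ (fun k => ((n.choose (k + 1) : ℕ) : ℝ) * _) n,
    Finset.sum_range_succ' (fun k => ((n.choose k : ℕ) : ℝ) * g ((n : ℝ) - 2 * k + 1)) n]
  simp only [Nat.choose_succ_self, Nat.cast_zero, zero_mul, Nat.choose_zero_right]
  have h1 : ∀ k : ℕ, (n : ℝ) + (1 : ℕ) - 2 * (k + (1 : ℕ)) = n - 2 * k - 1 := fun k => by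
    push_cast; ring
  have h2 : ∀ k : ℕ, (n : ℝ) - 2 * (k + 1 : ℕ) + 1 = n - 2 * k - 1 := fun k => by
    push_cast; ring
  have h3 : (n : ℝ) + (1 : ℕ) - 2 * 0 = n - 2 * 0 + 1 := by push_cast; ring
  simp only [h1, h2, h3]
  ring

theorem binomSum_sq (n : ℕ) : binomSum n (fun x => x ^ 2) = n * 2 ^ n := by
  induction n with
  | zero => simp [binomSum]
  | succ n ih =>
    rw [binomSum_succ, ← binomSum_add]
    have : (fun x : ℝ => (x + 1) ^ 2 + (x - 1) ^ 2) = fun x => 2 * x ^ 2 + 2 * 1 := by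
      ext x; ring
    rw [this, binomSum_add, binomSum_const_mul, binomSum_const_mul, ih, binomSum_one]
    push_cast; ring

theorem binomSum_pow_four (n : ℕ) :
    binomSum n (fun x => x ^ 4) = (3 * n ^ 2 - 2 * n) * 2 ^ n := by
  induction n with
  | zero => simp [binomSum]
  | succ n ih =>
    rw [binomSum_succ, ← binomSum_add]
    have : (fun x : ℝ => (x + 1) ^ 4 + (x - 1) ^ 4)
        = fun x => (2 * x ^ 4 + 12 * x ^ 2) + 2 * 1 := by
      ext x; ring
    rw [this, binomSum_add, binomSum_add, binomSum_const_mul, binomSum_const_mul,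
      binomSum_const_mul, ih, binomSum_one, binomSum_sq]
    push_cast; ring

theorem binomSum_posPart_sq (n : ℕ) : binomSum n (fun x => max x 0 ^ 2) = n * 2 ^ n / 2 := by
  have h := binomSum_neg n (fun x => max x 0 ^ 2)
  have h2 : binomSum n (fun x => max (-x) 0 ^ 2 + max x 0 ^ 2) = n * 2 ^ n := by
    rw [← binomSum_sq]
    congr 1
    ext x
    rcases le_total x 0 with hx | hx
    · rw [max_eq_right hx, max_eq_left (by linarith)]; ring
    · rw [max_eq_left hx, max_eq_right (by linarith)]; ring
  rw [binomSum_add] at h2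
  linarith

theorem binomSum_posPart_pow_four_le (n : ℕ) :
    binomSum n (fun x => max x 0 ^ 4) ≤ 3 * n ^ 2 * 2 ^ n := by
  have h : binomSum n (fun x => max x 0 ^ 4) ≤ binomSum n (fun x => x ^ 4) := by
    refine binomSum_mono n fun x => ?_
    rcases le_total x 0 with hx | hx
    · rw [max_eq_right hx]; simpa using Even.pow_nonneg (by decide : Even 4) x
    · rw [max_eq_left hx]
  rw [binomSum_pow_four] at h
  have : (0 : ℝ) ≤ 2 * n * 2 ^ n := by positivity
  linarith

/-- Telescoping: `C(m+1,k) (m+1-2k) = (m+1) (C(m,k) - C(m,k-1))`. Stopped at the middle of the row,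
this puts the first half moment in closed form. -/
theorem sum_choose_mul_sub (m j : ℕ) :
    ∑ k ∈ Finset.range (j + 1), ((m + 1).choose k : ℝ) * ((m : ℝ) + 1 - 2 * k)
      = (m + 1) * m.choose j := by
  induction j with
  | zero => simp
  | succ j ih =>
    rw [Finset.sum_range_succ, ih]
    have h1 : ((m : ℝ) + 1) * m.choose j = (m + 1).choose (j + 1) * (j + 1) := by
      exact_mod_cast Nat.add_one_mul_choose_eq m j
    have h2 : ((m + 1).choose (j + 1) : ℝ) = m.choose j + m.choose (j + 1) := by
      exact_mod_cast Nat.choose_succ_succ m j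
    push_cast
    linear_combination 2 * h1 + ((m : ℝ) + 1) * h2

/-- The cubic sum telescopes as well. At the middle of row `n = m + 1` the extra factor is `2n` for
even `n` and `2n - 1` for odd `n`, so the third half moment is an explicit multiple of the first. -/
theorem sum_choose_mul_sub_pow_three (m j : ℕ) :
    ∑ k ∈ Finset.range (j + 1), ((m + 1).choose k : ℝ) * ((m : ℝ) + 1 - 2 * k) ^ 3
      = ((m : ℝ) + 1) * m.choose j * (((m : ℝ) + 1 - 2 * j) ^ 2 + 4 * j) := by
  induction j with
  | zero =>
    simp only [zero_add, Finset.range_one, Finset.sum_singleton, Nat.choose_zero_right,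
      Nat.cast_zero]
    ring
  | succ j ih =>
    rw [Finset.sum_range_succ, ih]
    have h1 : ((m : ℝ) + 1) * m.choose j = (m + 1).choose (j + 1) * (j + 1) := by
      exact_mod_cast Nat.add_one_mul_choose_eq m j
    have h2 : ((m + 1).choose (j + 1) : ℝ) = m.choose j + m.choose (j + 1) := by
      exact_mod_cast Nat.choose_succ_succ m j
    push_cast
    linear_combination (((m : ℝ) + 1 - 2 * j) ^ 2 + 4 * j
      + (((m : ℝ) + 1 - 2 * (j + 1)) ^ 2 + 4 * (j + 1))) * h1
      + ((m : ℝ) + 1) * (((m : ℝ) + 1 - 2 * (j + 1)) ^ 2 + 4 * (j + 1)) * h2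

theorem binomSum_eq_sum_half (n : ℕ) (g : ℝ → ℝ) (hg : ∀ x < 0, g x = 0) :
    binomSum n g
      = ∑ k ∈ Finset.range (n / 2 + 1), (n.choose k : ℝ) * g ((n : ℝ) - 2 * k) := by
  unfold binomSum
  symm
  refine Finset.sum_subset (Finset.range_mono (by omega)) fun k _ hk => ?_
  have hk' : n + 1 ≤ 2 * k := by
    have := Finset.mem_range.not.1 hk
    omega
  have : (n : ℝ) + 1 ≤ 2 * k := by exact_mod_cast hk'
  rw [hg _ (by linarith), mul_zero]

theorem sub_two_mul_nonneg_of_mem_range_half {n k : ℕ} (hk : k ∈ Finset.range (n / 2 + 1)) :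
    0 ≤ (n : ℝ) - 2 * k := by
  have : 2 * k ≤ n := by
    have := Finset.mem_range.1 hk
    omega
  have : (2 : ℝ) * k ≤ n := by exact_mod_cast this
  linarith

theorem binomSum_posPart (m : ℕ) :
    binomSum (m + 1) (fun x => max x 0) = (m + 1) * m.choose ((m + 1) / 2) := by
  rw [binomSum_eq_sum_half _ _ fun x hx => max_eq_right hx.le, ← sum_choose_mul_sub]
  refine Finset.sum_congr rfl fun k hk => ?_
  rw [max_eq_left (sub_two_mul_nonneg_of_mem_range_half hk)]
  push_cast; ring

theorem binomSum_posPart_pow_three (m : ℕ) :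
    binomSum (m + 1) (fun x => max x 0 ^ 3)
      = binomSum (m + 1) (fun x => max x 0) *
        (((m : ℝ) + 1 - 2 * ((m + 1) / 2 : ℕ)) ^ 2 + 4 * ((m + 1) / 2 : ℕ)) := by
  rw [binomSum_posPart, ← sum_choose_mul_sub_pow_three,
    binomSum_eq_sum_half _ _ fun x hx => by simp [max_eq_right hx.le]]
  refine Finset.sum_congr rfl fun k hk => ?_
  rw [max_eq_left (sub_two_mul_nonneg_of_mem_range_half hk)]
  push_cast; ring

theorem sum_range_choose_succ (n j : ℕ) :
    ∑ k ∈ Finset.range (j + 1), ((n + 1).choose k : ℝ)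
      = 2 * ∑ k ∈ Finset.range (j + 1), (n.choose k : ℝ) - n.choose j := by
  induction j with
  | zero => simp; norm_num
  | succ j ih =>
    rw [Finset.sum_range_succ, ih, Finset.sum_range_succ _ (j + 1), Nat.choose_succ_succ]
    push_cast; ring

/-- Up to half of the sum, `∑ C(n, k) (n - 2 k - 1)` is positive as soon as `n ≥ 3`. -/
theorem sum_half_choose_lt (m : ℕ) (hm : 2 ≤ m) :
    ∑ k ∈ Finset.range ((m + 1) / 2 + 1), ((m + 1).choose k : ℝ)
      < (m + 1) * m.choose ((m + 1) / 2) := by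
  rcases Nat.even_or_odd' m with ⟨h, rfl | rfl⟩
  · have e : (2 * h + 1) / 2 = h := by omega
    rw [e]
    have h1 : ∑ k ∈ Finset.range (h + 1), ((2 * h + 1).choose k : ℝ) = 4 ^ h := by
      exact_mod_cast Nat.sum_range_choose_halfway h
    have h2 : (4 : ℝ) ^ h ≤ 2 * h * (2 * h).choose h := by
      have := Nat.four_pow_le_two_mul_self_mul_centralBinom h (by omega)
      rw [Nat.centralBinom_eq_two_mul_choose] at this
      exact_mod_cast this
    have h3 : (0 : ℝ) < (2 * h).choose h := by
      exact_mod_cast Nat.choose_pos (by omega)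
    rw [h1]
    push_cast
    linarith
  · obtain ⟨g, rfl⟩ : ∃ g, h = g + 1 := ⟨h - 1, by omega⟩
    have e : (2 * (g + 1) + 1 + 1) / 2 = g + 2 := by omega
    rw [e]
    -- For the even row `2(g+2)` the half sum is `(4^(g+2) + centralBinom)/2`, so the claim reduces
    -- to this. The Mathlib bound starts at index `4`; indices `2` and `3` are checked numerically.
    have key : (4 : ℝ) ^ (g + 2) < (2 * (g + 2) - 1) * (g + 2).centralBinom := by
      by_cases hg : g ≤ 1
      · interval_cases g <;> norm_num [Nat.centralBinom, Nat.choose]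
      · have h2 : (4 : ℝ) ^ (g + 2) < (g + 2 : ℕ) * (g + 2).centralBinom := by
          exact_mod_cast Nat.four_pow_lt_mul_centralBinom (g + 2) (by omega)
        refine h2.trans_le ?_
        gcongr
        push_cast
        linarith [(Nat.cast_nonneg g : (0 : ℝ) ≤ g)]
    have h1 : ∑ k ∈ Finset.range (g + 2 + 1), ((2 * (g + 2) + 1).choose k : ℝ) = 4 ^ (g + 2) := by
      exact_mod_cast Nat.sum_range_choose_halfway (g + 2)
    rw [sum_range_choose_succ, ← Nat.centralBinom_eq_two_mul_choose] at h1
    have h3 : ((2 * (g + 1) + 1 : ℕ) + 1 : ℝ) * (2 * (g + 1) + 1).choose (g + 2)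
        = (g + 2) * (g + 2).centralBinom := by
      have a1 := Nat.add_one_mul_choose_eq (2 * (g + 1) + 1) (g + 1)
      have a2 : (2 * (g + 1) + 1).choose (g + 2) = (2 * (g + 1) + 1).choose (g + 1) :=
        Nat.choose_symm_of_eq_add (by omega)
      rw [Nat.centralBinom_eq_two_mul_choose, a2]
      have a3 : 2 * (g + 1) + 1 + 1 = 2 * (g + 2) := by ring
      rw [a3] at a1
      have a4 : (((2 * (g + 2)) * (2 * (g + 1) + 1).choose (g + 1) : ℕ) : ℝ)
        = (((2 * (g + 2)).choose (g + 1 + 1) * (g + 1 + 1) : ℕ) : ℝ) := by exact_mod_cast a1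
      push_cast at a4 ⊢
      linarith
    have e2 : 2 * (g + 1) + 1 + 1 = 2 * (g + 2) := by ring
    rw [h3, e2]
    linarith

/-! ### The linearization of the drift at zero -/

/-- Up to the factor `2 / 2 ^ n`, the derivative at `0` of the drift for batches of size `n + 1`. -/
def rbSlope (n : ℕ) (β : ℝ) : ℝ :=
  binomSum n fun x => max x 0 * (1 - Real.exp (-(2 * β / (n + 1)) * max x 0))
    - Real.exp (-(2 * β / (n + 1)) * max x 0)

/-- With `n = p - 1`, the quantity `x = n - 2k` is the total spin of the other batch members when
`k` of them are minus. `S₁` penalizes the negative part of `x`, `S₂` the positive part, so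
reflection exchanges them at `m = 0`. -/
theorem rbS1_succ (n : ℕ) (β m : ℝ) :
    rbS1 (n + 1) β m = ∑ k ∈ Finset.range (n + 1), (n.choose k : ℝ) *
      (((1 - m) / 2) ^ k * ((1 + m) / 2) ^ (n - k)) *
        Real.exp (-(2 * β / (n + 1)) * max (-((n : ℝ) - 2 * k)) 0) := by
  unfold rbS1
  refine Finset.sum_congr rfl fun k _ => ?_
  have h : max ((2 * (k : ℝ) + 1 - (n + 1 : ℕ)) / (n + 1 : ℕ)) 0
      = max (-((n : ℝ) - 2 * k)) 0 / (n + 1) := by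
    rw [max_div_div_right (by positivity : (0 : ℝ) ≤ n + 1) _ 0 |>.symm]
    push_cast
    rw [zero_div]
    congr 2
    ring
  rw [h, Nat.add_sub_cancel]
  rw [show -2 * β * (max (-((n : ℝ) - 2 * k)) 0 / (n + 1))
    = -(2 * β / (n + 1)) * max (-((n : ℝ) - 2 * k)) 0 by ring]
  ring

theorem rbS2_succ (n : ℕ) (β m : ℝ) :
    rbS2 (n + 1) β m = ∑ k ∈ Finset.range (n + 1), (n.choose k : ℝ) *
      (((1 - m) / 2) ^ k * ((1 + m) / 2) ^ (n - k)) *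
        Real.exp (-(2 * β / (n + 1)) * max ((n : ℝ) - 2 * k) 0) := by
  unfold rbS2
  refine Finset.sum_congr rfl fun k _ => ?_
  have h : max ((((n + 1 : ℕ) : ℝ) - 1 - 2 * k) / (n + 1 : ℕ)) 0
      = max ((n : ℝ) - 2 * k) 0 / (n + 1) := by
    rw [max_div_div_right (by positivity : (0 : ℝ) ≤ n + 1) _ 0 |>.symm]
    push_cast
    rw [zero_div]
    congr 2
    ring
  rw [h, Nat.add_sub_cancel]
  rw [show -2 * β * (max ((n : ℝ) - 2 * k) 0 / (n + 1))
    = -(2 * β / (n + 1)) * max ((n : ℝ) - 2 * k) 0 by ring]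
  ring

theorem contDiff_rbDrift (p : ℕ) (β : ℝ) : ContDiff ℝ 1 (rbDrift p β) := by
  unfold rbDrift rbS1 rbS2
  fun_prop

theorem hasDerivAt_binomial_weight (n k : ℕ) (hk : k ≤ n) :
    HasDerivAt (fun m : ℝ => ((1 - m) / 2) ^ k * ((1 + m) / 2) ^ (n - k))
      (((n : ℝ) - 2 * k) / 2 ^ n) 0 := by
  have h1 : HasDerivAt (fun m : ℝ => ((1 - m) / 2) ^ k) (-(k / 2 ^ k)) 0 := by
    have := ((((hasDerivAt_id (0 : ℝ)).const_sub 1).div_const 2).pow k)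
    refine this.congr_deriv ?_
    rcases k with _ | k
    · simp
    · simp only [id, Nat.add_sub_cancel, sub_zero, one_div, inv_pow]
      push_cast
      field_simp
      ring
  have h2 : HasDerivAt (fun m : ℝ => ((1 + m) / 2) ^ (n - k)) ((n - k : ℕ) / 2 ^ (n - k)) 0 := by
    have := ((((hasDerivAt_id (0 : ℝ)).const_add 1).div_const 2).pow (n - k))
    refine this.congr_deriv ?_
    rcases n - k with _ | j
    · simp
    · simp only [id, Nat.add_sub_cancel, add_zero, one_div, inv_pow]
      push_cast
      field_simp
      ring
  refine (h1.mul h2).congr_deriv ?_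
  have h3 : (2 : ℝ) ^ n = 2 ^ k * 2 ^ (n - k) := by rw [← pow_add, Nat.add_sub_cancel' hk]
  rw [h3, Nat.cast_sub hk]
  simp only [sub_zero, add_zero, one_div, inv_pow]
  field_simp
  ring

theorem binomial_weight_zero (n k : ℕ) (hk : k ≤ n) :
    ((1 - (0 : ℝ)) / 2) ^ k * ((1 + 0) / 2) ^ (n - k) = 1 / 2 ^ n := by
  rw [sub_zero, add_zero, ← pow_add, Nat.add_sub_cancel' hk, one_div_pow]

theorem rbS1_zero (n : ℕ) (β : ℝ) :
    rbS1 (n + 1) β 0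
      = binomSum n (fun x => Real.exp (-(2 * β / (n + 1)) * max x 0)) / 2 ^ n := by
  rw [rbS1_succ, ← binomSum_neg, binomSum, Finset.sum_div]
  refine Finset.sum_congr rfl fun k hk => ?_
  rw [binomial_weight_zero n k (Nat.lt_succ_iff.1 (Finset.mem_range.1 hk))]
  ring

theorem rbS2_zero (n : ℕ) (β : ℝ) :
    rbS2 (n + 1) β 0
      = binomSum n (fun x => Real.exp (-(2 * β / (n + 1)) * max x 0)) / 2 ^ n := by
  rw [rbS2_succ, binomSum, Finset.sum_div]
  refine Finset.sum_congr rfl fun k hk => ?_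
  rw [binomial_weight_zero n k (Nat.lt_succ_iff.1 (Finset.mem_range.1 hk))]
  ring

theorem rbDrift_zero (p : ℕ) (hp : 1 ≤ p) (β : ℝ) : rbDrift p β 0 = 0 := by
  obtain ⟨n, rfl⟩ : ∃ n, p = n + 1 := ⟨p - 1, by omega⟩
  rw [rbDrift, rbS1_zero, rbS2_zero]
  ring

theorem hasDerivAt_rbS1_zero (n : ℕ) (β : ℝ) :
    HasDerivAt (rbS1 (n + 1) β)
      (-binomSum n (fun x => x * Real.exp (-(2 * β / (n + 1)) * max x 0)) / 2 ^ n) 0 := by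
  have : rbS1 (n + 1) β = fun m => _ := funext fun m => rbS1_succ n β m
  rw [this]
  refine (HasDerivAt.fun_sum fun k hk => ((hasDerivAt_binomial_weight n k
    (Nat.lt_succ_iff.1 (Finset.mem_range.1 hk))).const_mul _).mul_const _).congr_deriv ?_
  rw [← binomSum_neg, binomSum, ← Finset.sum_neg_distrib, Finset.sum_div]
  exact Finset.sum_congr rfl fun k _ => by ring

theorem hasDerivAt_rbS2_zero (n : ℕ) (β : ℝ) :
    HasDerivAt (rbS2 (n + 1) β)
      (binomSum n (fun x => x * Real.exp (-(2 * β / (n + 1)) * max x 0)) / 2 ^ n) 0 := by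
  have : rbS2 (n + 1) β = fun m => _ := funext fun m => rbS2_succ n β m
  rw [this]
  refine (HasDerivAt.fun_sum fun k hk => ((hasDerivAt_binomial_weight n k
    (Nat.lt_succ_iff.1 (Finset.mem_range.1 hk))).const_mul _).mul_const _).congr_deriv ?_
  rw [binomSum, Finset.sum_div]
  exact Finset.sum_congr rfl fun k _ => by ring

/-- For `x < 0` the exponential is `1`, so the negative half contributes the first half moment;
reflecting it to the positive half produces the factor `1 - exp`. -/
theorem rbSlope_eq (n : ℕ) (β : ℝ) :
    rbSlope n β = -binomSum n (fun x => x * Real.exp (-(2 * β / (n + 1)) * max x 0))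
      - binomSum n (fun x => Real.exp (-(2 * β / (n + 1)) * max x 0)) := by
  set c := -(2 * β / ((n : ℝ) + 1)) with hc
  have h : (fun x : ℝ => x * Real.exp (c * max x 0))
      = fun x => (max x 0 * Real.exp (c * max x 0)) - max (-x) 0 := by
    ext x
    rcases le_total x 0 with hx | hx
    · rw [max_eq_right hx, max_eq_left (by linarith : 0 ≤ -x)]; simp
    · rw [max_eq_left hx, max_eq_right (by linarith : -x ≤ 0)]; simp
  have h2 : rbSlope n β = binomSum n (fun x => max x 0 - max x 0 * Real.exp (c * max x 0)
      - Real.exp (c * max x 0)) := by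
    rw [rbSlope]; congr 1; ext x; ring
  rw [h, h2, binomSum_sub, binomSum_sub, binomSum_sub, binomSum_neg n fun x => max x 0]
  ring

theorem hasDerivAt_rbDrift_zero (n : ℕ) (β : ℝ) :
    HasDerivAt (rbDrift (n + 1) β) (2 / 2 ^ n * rbSlope n β) 0 := by
  have h1 := hasDerivAt_rbS1_zero n β
  have h2 := hasDerivAt_rbS2_zero n β
  refine ((h1.sub h2).sub ((hasDerivAt_id (0 : ℝ)).mul (h1.add h2))).congr_deriv ?_
  simp only [id, Pi.add_apply, rbS1_zero, rbS2_zero, rbSlope_eq]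
  ring

theorem continuous_rbSlope (n : ℕ) : Continuous (rbSlope n) := by
  unfold rbSlope binomSum
  fun_prop

/-- Both occurrences of the exponential carry a nonpositive coefficient, and the exponential
decreases in `β`. -/
theorem rbSlope_strictMono (n : ℕ) (hn : 1 ≤ n) : StrictMono (rbSlope n) := by
  intro a b hab
  have hn' : (0 : ℝ) < n := by exact_mod_cast hn
  have key : ∀ x : ℝ, Real.exp (-(2 * b / (n + 1)) * max x 0)
      ≤ Real.exp (-(2 * a / (n + 1)) * max x 0) := fun x => by
    gcongr
  unfold rbSlope binomSum
  -- Strictness comes from `k = 0`, where `x = n > 0`.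
  refine Finset.sum_lt_sum (fun k _ => ?_) ⟨0, by simp, ?_⟩
  · refine mul_le_mul_of_nonneg_left ?_ (Nat.cast_nonneg _)
    have := mul_le_mul_of_nonneg_left (key ((n : ℝ) - 2 * k)) (le_max_right ((n : ℝ) - 2 * k) 0)
    linarith [key ((n : ℝ) - 2 * k)]
  · have e : max ((n : ℝ) - 2 * (0 : ℕ)) 0 = n := by simp
    simp only [e]
    have h : Real.exp (-(2 * b / (n + 1)) * n) < Real.exp (-(2 * a / (n + 1)) * n) := by
      gcongr
    have := mul_le_mul_of_nonneg_left h.le hn'.le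
    simp only [Nat.choose_zero_right, Nat.cast_one, one_mul]
    linarith

theorem rbSlope_zero_neg (n : ℕ) : rbSlope n 0 < 0 := by
  have : rbSlope n 0 = -2 ^ n := by
    rw [← binomSum_one n]
    simp [rbSlope, binomSum]
  rw [this]
  simp

/-- As `β → ∞` the exponential becomes the indicator of `x ≤ 0`, and the limit is the first half
moment minus the weight of `x ≤ 0`, which is positive from `n = 3` on. -/
theorem exists_rbSlope_pos (n : ℕ) (hn : 3 ≤ n) : ∃ β, 0 < β ∧ 0 < rbSlope n β := by
  obtain ⟨m, rfl⟩ : ∃ m, n = m + 1 := ⟨n - 1, by omega⟩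
  have hlim : Tendsto (rbSlope (m + 1)) atTop
      (𝓝 (binomSum (m + 1) fun x => max x 0 * (1 - if 0 < x then 0 else 1)
        - if 0 < x then 0 else 1)) := by
    unfold rbSlope binomSum
    refine tendsto_finsetSum _ fun k _ => Tendsto.const_mul _ ?_
    have : Tendsto (fun β : ℝ => Real.exp (-(2 * β / ((m + 1 : ℕ) + 1))
        * max (((m + 1 : ℕ) : ℝ) - 2 * k) 0)) atTop
        (𝓝 (if 0 < ((m + 1 : ℕ) : ℝ) - 2 * k then 0 else 1)) := by
      split_ifs with h
      · rw [max_eq_left h.le]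
        refine Real.tendsto_exp_atBot.comp ?_
        have : (fun β : ℝ => -(2 * β / ((m + 1 : ℕ) + 1)) * (((m + 1 : ℕ) : ℝ) - 2 * k))
            = fun β => -(2 / ((m + 1 : ℕ) + 1) * (((m + 1 : ℕ) : ℝ) - 2 * k)) * β := by
          ext β; ring
        rw [this]
        refine Tendsto.const_mul_atTop_of_neg ?_ tendsto_id
        rw [neg_lt_zero]
        positivity
      · rw [max_eq_right (not_lt.1 h)]
        simp
    exact ((this.const_sub 1).const_mul _).sub this
  have hpos : 0 < binomSum (m + 1) fun x => max x 0 * (1 - if 0 < x then 0 else 1)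
      - if 0 < x then 0 else 1 := by
    have e : (fun x : ℝ => max x 0 * (1 - if 0 < x then 0 else 1) - if 0 < x then 0 else 1)
        = fun x => max x 0 - if 0 < x then 0 else 1 := by
      ext x
      split_ifs with h
      · simp
      · rw [max_eq_right (not_lt.1 h)]; simp
    rw [e, binomSum_sub, sub_pos, binomSum_posPart]
    refine lt_of_eq_of_lt ?_ (sum_half_choose_lt m (by omega))
    -- Reflection turns the weight of `x ≤ 0` into that of `x ≥ 0`, a half-row sum of binomial
    -- coefficients.
    rw [← binomSum_neg, binomSum_eq_sum_half]
    · refine Finset.sum_congr rfl fun k hk => ?_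
      have := sub_two_mul_nonneg_of_mem_range_half hk
      rw [if_neg (by linarith)]; simp
    · intro x hx
      rw [if_pos (by linarith)]
  obtain ⟨β, h1, h2⟩ := ((eventually_gt_atTop 0).and (hlim.eventually (lt_mem_nhds hpos))).exists
  exact ⟨β, h1, h2⟩

theorem exists_rbSlope_eq_zero (n : ℕ) (hn : 3 ≤ n) : ∃ β, 0 < β ∧ rbSlope n β = 0 := by
  obtain ⟨b, hb, hb'⟩ := exists_rbSlope_pos n hn
  obtain ⟨c, hc, hc'⟩ := intermediate_value_Ioo hb.le (continuous_rbSlope n).continuousOn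
    ⟨rbSlope_zero_neg n, hb'⟩
  exact ⟨c, hc.1, hc'⟩

/-! ### Batches of size two and three -/

theorem rbDrift_two (β m : ℝ) : rbDrift 2 β m = -2 * m * Real.exp (-β) := by
  have h1 : max (-(1 / 2) : ℝ) 0 = 0 := max_eq_right (by norm_num)
  have h2 : max (1 / 2 : ℝ) 0 = 1 / 2 := max_eq_left (by norm_num)
  have h3 : -(2 * β) * (1 / 2) = -β := by ring
  unfold rbDrift rbS1 rbS2
  simp [Finset.sum_range_succ]
  norm_num [h1, h2, h3]
  ring_nf

theorem rbDrift_three (β m : ℝ) : rbDrift 3 β m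
    = m * (-(1 + 3 * Real.exp (-(4 * β / 3))) / 2
      + m ^ 2 * (1 - Real.exp (-(4 * β / 3))) / 2) := by
  have h1 : max (-(2 / 3) : ℝ) 0 = 0 := max_eq_right (by norm_num)
  have h2 : max (2 / 3 : ℝ) 0 = 2 / 3 := max_eq_left (by norm_num)
  have h3 : -(2 * β) * (2 / 3) = -(4 * β / 3) := by ring
  unfold rbDrift rbS1 rbS2
  simp [Finset.sum_range_succ]
  norm_num [h1, h2, h3]
  ring_nf

/-! ### The critical inverse temperature for large batches -/

/-- Multiply by `exp u ≥ 1 + u + u²/2` and use `(1 - u + u²/2)(1 + u + u²/2) = 1 + u⁴/4 ≥ 1`. -/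
theorem exp_neg_le_quadratic {u : ℝ} (hu : 0 ≤ u) : Real.exp (-u) ≤ 1 - u + u ^ 2 / 2 := by
  have h := Real.quadratic_le_exp_of_nonneg hu
  have h1 : 0 < 1 - u + u ^ 2 / 2 := by nlinarith [sq_nonneg (u - 1)]
  have h2 : 1 ≤ (1 - u + u ^ 2 / 2) * Real.exp u := by
    refine le_trans ?_ (mul_le_mul_of_nonneg_left h h1.le)
    nlinarith [sq_nonneg (u ^ 2)]
  calc Real.exp (-u) = 1 * Real.exp (-u) := (one_mul _).symm
    _ ≤ (1 - u + u ^ 2 / 2) * Real.exp u * Real.exp (-u) :=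
        mul_le_mul_of_nonneg_right h2 (Real.exp_pos _).le
    _ = 1 - u + u ^ 2 / 2 := by rw [mul_assoc, ← Real.exp_add]; simp

theorem cubic_le_exp_neg {u : ℝ} (hu : 0 ≤ u) :
    1 - u + u ^ 2 / 2 - u ^ 3 / 6 ≤ Real.exp (-u) := by
  have hd : ∀ x : ℝ, HasDerivAt (fun x : ℝ => Real.exp (-x) - (1 - x + x ^ 2 / 2 - x ^ 3 / 6))
      (-Real.exp (-x) + (1 - x + x ^ 2 / 2)) x := fun x => by
    have h1 := (hasDerivAt_neg x).exp
    have h2 := (((hasDerivAt_id x).const_sub 1).add (((hasDerivAt_id x).pow 2).div_const 2)).sub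
      (((hasDerivAt_id x).pow 3).div_const 6)
    refine (h1.sub h2).congr_deriv ?_
    simp only [id]
    push_cast
    ring
  have hm : MonotoneOn (fun x : ℝ => Real.exp (-x) - (1 - x + x ^ 2 / 2 - x ^ 3 / 6)) (Ici 0) := by
    refine monotoneOn_of_deriv_nonneg (convex_Ici 0)
      (fun x _ => (hd x).continuousAt.continuousWithinAt)
      (fun x _ => (hd x).differentiableAt.differentiableWithinAt) fun x hx => ?_
    rw [interior_Ici] at hx
    rw [(hd x).deriv]
    linarith [exp_neg_le_quadratic (le_of_lt hx)]
  have := hm self_mem_Ici hu hu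
  simp only [neg_zero, Real.exp_zero] at this
  linarith

/-- Both exponentials are replaced by their quadratic upper bound; what remains are half moments of
orders one to three. -/
theorem rbSlope_ge (n : ℕ) {β c : ℝ} (hβ : 0 ≤ β) (hc : c = 2 * β / (n + 1)) :
    c * (n * 2 ^ n / 2) - c ^ 2 / 2 * binomSum n (fun x => max x 0 ^ 3) - 2 ^ n
      + c * binomSum n (fun x => max x 0) - c ^ 2 / 2 * (n * 2 ^ n / 2) ≤ rbSlope n β := by
  have hc0 : 0 ≤ c := by rw [hc]; positivity
  rw [← binomSum_posPart_sq, ← binomSum_one n]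
  simp only [← binomSum_const_mul, ← binomSum_sub, ← binomSum_add]
  unfold rbSlope
  rw [← hc]
  refine binomSum_mono n fun x => ?_
  have hw := le_max_right x 0
  set w := max x 0
  have h := exp_neg_le_quadratic (mul_nonneg hc0 hw)
  rw [neg_mul]
  have := mul_le_mul_of_nonneg_left h hw
  nlinarith

/-- Here the weighted exponential is bounded below to third order and the other one to first order.
The cubic term costs a fourth moment, of order `n²`, for which a crude bound suffices. -/
theorem rbSlope_le (n : ℕ) {β c : ℝ} (hβ : 0 ≤ β) (hc : c = 2 * β / (n + 1)) :
    rbSlope n β ≤ c * (n * 2 ^ n / 2) - c ^ 2 / 2 * binomSum n (fun x => max x 0 ^ 3)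
      + c ^ 3 / 6 * (3 * n ^ 2 * 2 ^ n) - 2 ^ n + c * binomSum n (fun x => max x 0) := by
  have hc0 : 0 ≤ c := by rw [hc]; positivity
  have h4 := mul_le_mul_of_nonneg_left (binomSum_posPart_pow_four_le n)
    (by positivity : 0 ≤ c ^ 3 / 6)
  refine le_trans ?_ (add_le_add_left (sub_le_sub_right (add_le_add_right h4 _) _) _)
  rw [← binomSum_posPart_sq, ← binomSum_one n]
  simp only [← binomSum_const_mul, ← binomSum_sub, ← binomSum_add]
  unfold rbSlope
  rw [← hc]
  refine binomSum_mono n fun x => ?_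
  have hw := le_max_right x 0
  set w := max x 0
  have h := cubic_le_exp_neg (mul_nonneg hc0 hw)
  have h' := Real.add_one_le_exp (-(c * w))
  rw [neg_mul]
  have := mul_le_mul_of_nonneg_left h hw
  nlinarith

/-! ### Wallis' product and the limits of the half moments. -/

theorem wallis_mul_centralBinom_sq (h : ℕ) :
    Real.Wallis.W h * ((h.centralBinom : ℝ) / 4 ^ h) ^ 2 * (2 * h + 1) = 1 := by
  rw [Real.Wallis.W_eq_factorial_ratio]
  have h1 : ((2 * h).factorial : ℝ) = h.centralBinom * (h.factorial * h.factorial) := by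
    have := Nat.choose_mul_factorial_mul_factorial (n := 2 * h) (k := h) (by omega)
    rw [← Nat.centralBinom_eq_two_mul_choose, show 2 * h - h = h by omega] at this
    rw [← this]; push_cast; ring
  have h2 : (0 : ℝ) < h.factorial := by exact_mod_cast Nat.factorial_pos h
  have h3 : (0 : ℝ) < h.centralBinom := by exact_mod_cast Nat.centralBinom_pos h
  have h4 : (2 : ℝ) ^ (4 * h) = (4 ^ h) ^ 2 := by
    rw [← pow_mul, show (4 : ℝ) = 2 ^ 2 by norm_num, ← pow_mul]; congr 1; ring
  rw [h1, h4]
  field_simp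

theorem binomSum_posPart_even (h : ℕ) :
    binomSum (2 * h) (fun x => max x 0) / 2 ^ (2 * h) = h * (h.centralBinom / 4 ^ h) := by
  rcases h with _ | g
  · simp [binomSum]
  rw [show 2 * (g + 1) = 2 * g + 1 + 1 by ring, binomSum_posPart,
    show (2 * g + 1 + 1) / 2 = g + 1 by omega]
  have a1 := Nat.add_one_mul_choose_eq (2 * g + 1) g
  have a2 : (2 * g + 1).choose (g + 1) = (2 * g + 1).choose g :=
    Nat.choose_symm_of_eq_add (by omega)
  rw [← a2] at a1
  have a3 : ((2 * g + 1 : ℕ) + 1 : ℝ) * (2 * g + 1).choose (g + 1)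
      = (g + 1).centralBinom * (g + 1) := by
    rw [Nat.centralBinom_eq_two_mul_choose]
    exact_mod_cast a1
  rw [a3, show (2 : ℝ) ^ (2 * g + 1 + 1) = 4 ^ (g + 1) by
    rw [show (4 : ℝ) = 2 ^ 2 by norm_num, ← pow_mul]; congr 1]
  push_cast
  ring

theorem binomSum_posPart_odd (h : ℕ) :
    binomSum (2 * h + 1) (fun x => max x 0) / 2 ^ (2 * h + 1)
      = (2 * h + 1) / 2 * (h.centralBinom / 4 ^ h) := by
  rw [binomSum_posPart, show (2 * h + 1) / 2 = h by omega, ← Nat.centralBinom_eq_two_mul_choose,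
    pow_succ, show (2 : ℝ) ^ (2 * h) = 4 ^ h by rw [pow_mul]; norm_num]
  push_cast
  ring

/-- The Wallis identity is exact: the middle quantity equals the lower bound for even `n` and the
upper bound for odd `n`. Since `W → π/2`, this gives `(E X₊)² ~ n/(2π)`. -/
theorem binomSum_posPart_sq_bounds (n : ℕ) :
    (n : ℝ) ^ 2 / (n + 1) ≤
        4 * Real.Wallis.W (n / 2) * (binomSum n (fun x => max x 0) / 2 ^ n) ^ 2 ∧
      4 * Real.Wallis.W (n / 2) * (binomSum n (fun x => max x 0) / 2 ^ n) ^ 2 ≤ n := by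
  have hn : (n : ℝ) ^ 2 / (n + 1) ≤ n := by
    rw [div_le_iff₀ (by positivity)]
    nlinarith [(Nat.cast_nonneg n : (0 : ℝ) ≤ n)]
  rcases Nat.even_or_odd' n with ⟨h, rfl | rfl⟩
  · rw [binomSum_posPart_even, show 2 * h / 2 = h by omega]
    have hw := wallis_mul_centralBinom_sq h
    have : 4 * Real.Wallis.W h * ((h : ℝ) * (h.centralBinom / 4 ^ h)) ^ 2
        = ((2 * h : ℕ) : ℝ) ^ 2 / ((2 * h : ℕ) + 1) := by
      rw [eq_div_iff (by positivity)]
      push_cast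
      linear_combination 4 * (h : ℝ) ^ 2 * hw
    rw [this]
    exact ⟨le_rfl, hn⟩
  · rw [binomSum_posPart_odd, show (2 * h + 1) / 2 = h by omega]
    have hw := wallis_mul_centralBinom_sq h
    have : 4 * Real.Wallis.W h * (((2 * h : ℝ) + 1) / 2 * (h.centralBinom / 4 ^ h)) ^ 2
        = (2 * h + 1 : ℕ) := by
      push_cast
      linear_combination (2 * (h : ℝ) + 1) * hw
    rw [this]
    exact ⟨hn, le_rfl⟩

theorem tendsto_inv_sqrt_add_two : Tendsto (fun m : ℕ => 1 / √((m : ℝ) + 2)) atTop (𝓝 0) := by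
  have h : Tendsto (fun m : ℕ => √((m : ℝ) + 2)) atTop atTop :=
    Real.tendsto_sqrt_atTop.comp (tendsto_atTop_add_const_right _ _ tendsto_natCast_atTop_atTop)
  simp only [one_div]
  exact h.inv_tendsto_atTop

theorem one_div_sqrt_add_two_sq (m : ℕ) : (1 / √((m : ℝ) + 2)) ^ 2 = 1 / (m + 2) := by
  rw [div_pow, Real.sq_sqrt (by positivity), one_pow]

theorem tendsto_one_div_add_two : Tendsto (fun m : ℕ => 1 / ((m : ℝ) + 2)) atTop (𝓝 0) := by
  have := tendsto_inv_sqrt_add_two.pow 2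
  simp only [one_div_sqrt_add_two_sq] at this
  simpa using this

theorem tendsto_binomSum_posPart : Tendsto (fun m : ℕ =>
    binomSum (m + 1) (fun x => max x 0) / 2 ^ (m + 1) * (1 / √((m : ℝ) + 2))) atTop
    (𝓝 (√(2 / Real.pi) / 2)) := by
  set A : ℕ → ℝ := fun n => binomSum n (fun x => max x 0) / 2 ^ n with hA
  have hA0 : ∀ n, 0 ≤ A n := fun n => div_nonneg
    (Finset.sum_nonneg fun k _ => mul_nonneg (Nat.cast_nonneg _) (le_max_right _ _))
    (by positivity)
  have hs := tendsto_one_div_add_two.const_sub 1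
  rw [sub_zero] at hs
  have hW : Tendsto (fun m : ℕ => (4 * Real.Wallis.W ((m + 1) / 2))⁻¹) atTop
      (𝓝 (4 * (Real.pi / 2))⁻¹) := by
    refine ((Real.Wallis.tendsto_W_nhds_pi_div_two.comp ?_).const_mul 4).inv₀ ?_
    · refine tendsto_atTop_atTop.2 fun b => ⟨2 * b, fun a ha => by omega⟩
    · positivity
  have hsq : Tendsto (fun m : ℕ => (A (m + 1) * (1 / √((m : ℝ) + 2))) ^ 2) atTop
      (𝓝 (4 * (Real.pi / 2))⁻¹) := by
    have hL := (hs.pow 2).mul hW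
    have hU := hs.mul hW
    rw [one_pow, one_mul] at hL
    rw [one_mul] at hU
    refine tendsto_of_tendsto_of_tendsto_of_le_of_le hL hU (fun m => ?_) fun m => ?_
    all_goals
      have hb := binomSum_posPart_sq_bounds (m + 1)
      have hw : 0 < 4 * Real.Wallis.W ((m + 1) / 2) :=
        mul_pos (by norm_num) (Real.Wallis.W_pos _)
      simp only [mul_pow, one_div_sqrt_add_two_sq]
      push_cast at hb
      have e : 1 - 1 / ((m : ℝ) + 2) = (m + 1) / (m + 2) := by field_simp; ring
      rw [e, ← div_eq_mul_inv]
    · rw [div_le_iff₀ hw]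
      calc (((m : ℝ) + 1) / (m + 2)) ^ 2 = ((m : ℝ) + 1) ^ 2 / (m + 1 + 1) * (1 / (m + 2)) := by
            field_simp; ring
        _ ≤ _ := mul_le_mul_of_nonneg_right hb.1 (by positivity)
        _ = _ := by ring
    · rw [le_div_iff₀ hw]
      calc A (m + 1) ^ 2 * (1 / ((m : ℝ) + 2)) * (4 * Real.Wallis.W ((m + 1) / 2))
          = 4 * Real.Wallis.W ((m + 1) / 2) * A (m + 1) ^ 2 * (1 / (m + 2)) := by ring
        _ ≤ ((m : ℝ) + 1) * (1 / (m + 2)) := mul_le_mul_of_nonneg_right hb.2 (by positivity)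
        _ = _ := by ring
  have h := (Real.continuous_sqrt.tendsto _).comp hsq
  have e1 : √(4 * (Real.pi / 2))⁻¹ = √(2 / Real.pi) / 2 := by
    rw [show (4 * (Real.pi / 2))⁻¹ = 2 / Real.pi / 2 ^ 2 by field_simp; norm_num,
      Real.sqrt_div (by positivity), Real.sqrt_sq (by norm_num)]
  rw [e1] at h
  refine h.congr fun m => ?_
  exact Real.sqrt_sq (mul_nonneg (hA0 _) (by positivity))

/-- The ratio of the third and the first absolute moment, divided by the batch size. -/
def momentRatio (m : ℕ) : ℝ :=
  (((m : ℝ) + 1 - 2 * ((m + 1) / 2 : ℕ)) ^ 2 + 4 * ((m + 1) / 2 : ℕ)) * (1 / √((m : ℝ) + 2)) ^ 2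

theorem tendsto_momentRatio : Tendsto momentRatio atTop (𝓝 2) := by
  have hL := (tendsto_one_div_add_two.const_mul 4).const_sub 2
  rw [mul_zero, sub_zero] at hL
  refine tendsto_of_tendsto_of_tendsto_of_le_of_le hL (tendsto_const_nhds (x := (2 : ℝ)))
    (fun m => ?_) fun m => ?_
  all_goals
    simp only [momentRatio, one_div_sqrt_add_two_sq]
    rcases Nat.even_or_odd' m with ⟨h, rfl | rfl⟩
    · rw [show (2 * h + 1) / 2 = h by omega]
      push_cast
      field_simp
      nlinarith [(Nat.cast_nonneg h : (0 : ℝ) ≤ h)]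
    · rw [show (2 * h + 1 + 1) / 2 = h + 1 by omega]
      push_cast
      field_simp
      nlinarith [(Nat.cast_nonneg h : (0 : ℝ) ≤ h)]

/-- Here `n = m + 1`, `p = m + 2`, so `c = 2β s²`. The quadratic moment term cancels the constant
`-1` up to `b s - s² - b s³`, and the first and third moments are also of order `s`, with `a` and
`r` convergent. So a factor `s` comes out of everything. -/
theorem rbSlope_scaled_bounds (m : ℕ) (b : ℝ) {s β a r : ℝ} (hs : s = 1 / √((m : ℝ) + 2))
    (hβ : β = 1 + b * s) (hβ0 : 0 ≤ β)
    (ha : a = binomSum (m + 1) (fun x => max x 0) / 2 ^ (m + 1) * s) (hr : r = momentRatio m) :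
    s * (b - s - b * s ^ 2 - 2 * β ^ 2 * r * a + 2 * β * a - β ^ 2 * (1 - s ^ 2) * s)
        ≤ rbSlope (m + 1) β / 2 ^ (m + 1) ∧
      rbSlope (m + 1) β / 2 ^ (m + 1) ≤
        s * (b - s - b * s ^ 2 - 2 * β ^ 2 * r * a + 2 * β * a
          + 4 * β ^ 3 * (1 - s ^ 2) ^ 2 * s) := by
  have hP : (m : ℝ) + 2 ≠ 0 := by positivity
  have hs2 : s ^ 2 * (m + 2) = 1 := by
    rw [hs, div_pow, Real.sq_sqrt (by positivity)]
    field_simp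
  have hn : ((m : ℝ) + 1) * s ^ 2 = 1 - s ^ 2 := by linear_combination hs2
  have hc : 2 * β * s ^ 2 = 2 * β / (((m + 1 : ℕ) : ℝ) + 1) := by
    rw [eq_div_iff (by positivity)]
    push_cast
    linear_combination 2 * β * hs2
  have h3 := binomSum_posPart_pow_three m
  have h1 := rbSlope_ge (m + 1) hβ0 hc
  have h2 := rbSlope_le (m + 1) hβ0 hc
  rw [h3] at h1 h2
  have h2n : (0 : ℝ) < 2 ^ (m + 1) := by positivity
  unfold momentRatio at hr
  rw [← hs] at hr
  set q := ((m : ℝ) + 1 - 2 * ((m + 1) / 2 : ℕ)) ^ 2 + 4 * ((m + 1) / 2 : ℕ)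
  set B := binomSum (m + 1) (fun x => max x 0)
  set D := (2 : ℝ) ^ (m + 1)
  have hB : B * s = a * D := by rw [ha]; field_simp
  push_cast at h1 h2
  constructor
  · rw [le_div_iff₀ h2n]
    refine le_of_eq_of_le ?_ h1
    rw [hr]
    linear_combination (exp := 1) (-(2 * β * s) + 2 * β ^ 2 * q * s ^ 3) * hB
      + (-β * D + β ^ 2 * s ^ 2 * D) * hn + (1 - s ^ 2) * D * (-hβ)
  · rw [div_le_iff₀ h2n]
    refine le_of_le_of_eq h2 ?_
    rw [hr]
    linear_combination (exp := 1) ((2 * β * s) - 2 * β ^ 2 * q * s ^ 3) * hB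
      + (β * D + 4 * β ^ 3 * s ^ 2 * D * (((m : ℝ) + 1) * s ^ 2 + (1 - s ^ 2))) * hn
      + (1 - s ^ 2) * D * hβ

/-- Serves both bounds at once: `g β s` is the remainder that distinguishes them. With `β → 1`, `r →
2`, `a → √(2/π)/2`, the moment terms leave `-4a + 2a = -2a`. -/
theorem tendsto_scaled_slope_bound (b : ℝ) {g : ℝ → ℝ → ℝ}
    (hg : Continuous fun z : ℝ × ℝ => g z.1 z.2) (hg0 : g 1 0 = 0) :
    Tendsto (fun m : ℕ => b - 1 / √((m : ℝ) + 2) - b * (1 / √((m : ℝ) + 2)) ^ 2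
      - 2 * (1 + b * (1 / √((m : ℝ) + 2))) ^ 2 * momentRatio m *
        (binomSum (m + 1) (fun x => max x 0) / 2 ^ (m + 1) * (1 / √((m : ℝ) + 2)))
      + 2 * (1 + b * (1 / √((m : ℝ) + 2))) *
        (binomSum (m + 1) (fun x => max x 0) / 2 ^ (m + 1) * (1 / √((m : ℝ) + 2)))
      + g (1 + b * (1 / √((m : ℝ) + 2))) (1 / √((m : ℝ) + 2))) atTop
      (𝓝 (b - √(2 / Real.pi))) := by
  have hs := tendsto_inv_sqrt_add_two
  have hβ := (hs.const_mul b).const_add 1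
  rw [mul_zero, add_zero] at hβ
  have ha := tendsto_binomSum_posPart
  have hgl := (hg.tendsto (1, 0)).comp (hβ.prodMk_nhds hs)
  have := (((((hs.const_sub b).sub ((hs.pow 2).const_mul b)).sub
    ((((hβ.pow 2).const_mul 2).mul tendsto_momentRatio).mul ha)).add
    ((hβ.const_mul 2).mul ha)).add hgl)
  rw [hg0, show b - 0 - b * 0 ^ 2 - 2 * 1 ^ 2 * 2 * (√(2 / Real.pi) / 2)
    + 2 * 1 * (√(2 / Real.pi) / 2) + 0 = b - √(2 / Real.pi) by ring] at this
  exact this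

theorem eventually_scaled_inverse_temperature_nonneg (b : ℝ) :
    ∀ᶠ m : ℕ in atTop, 0 ≤ 1 + b * (1 / √((m : ℝ) + 2)) := by
  have hβ := (tendsto_inv_sqrt_add_two.const_mul b).const_add 1
  rw [mul_zero, add_zero] at hβ
  exact hβ.eventually (le_mem_nhds one_pos)

theorem eventually_rbSlope_pos {b : ℝ} (hb : √(2 / Real.pi) < b) :
    ∀ᶠ m : ℕ in atTop, 0 < rbSlope (m + 1) (1 + b * (1 / √((m : ℝ) + 2))) := by
  have h := tendsto_scaled_slope_bound b (g := fun β s => -(β ^ 2 * (1 - s ^ 2) * s))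
    (by fun_prop) (by norm_num)
  filter_upwards [h.eventually (lt_mem_nhds (sub_pos.2 hb)),
    eventually_scaled_inverse_temperature_nonneg b] with m hm hβ
  have hs : 0 < 1 / √((m : ℝ) + 2) := by positivity
  have := (rbSlope_scaled_bounds m b rfl rfl hβ rfl rfl).1
  rw [← sub_eq_add_neg] at hm
  have h2 := (mul_pos hs hm).trans_le this
  exact (div_pos_iff_of_pos_right (by positivity)).1 h2

theorem eventually_rbSlope_neg {b : ℝ} (hb : b < √(2 / Real.pi)) :
    ∀ᶠ m : ℕ in atTop, rbSlope (m + 1) (1 + b * (1 / √((m : ℝ) + 2))) < 0 := by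
  have h := tendsto_scaled_slope_bound b (g := fun β s => 4 * β ^ 3 * (1 - s ^ 2) ^ 2 * s)
    (by fun_prop) (by norm_num)
  filter_upwards [h.eventually (gt_mem_nhds (sub_neg.2 hb)),
    eventually_scaled_inverse_temperature_nonneg b] with m hm hβ
  have hs : 0 < 1 / √((m : ℝ) + 2) := by positivity
  have := (rbSlope_scaled_bounds m b rfl rfl hβ rfl rfl).2
  have h2 := this.trans_lt (mul_neg_of_pos_of_neg hs hm)
  by_contra hc
  exact absurd h2 (not_lt.2 (div_nonneg (not_lt.1 hc) (by positivity)))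

/-- The zeros of the slopes are `1 + √(2 / (p π)) + o(1 / √p)`. -/
theorem isLittleO_rbSlope_root {βc : ℕ → ℝ} (h : ∀ n, 3 ≤ n → rbSlope n (βc (n + 1)) = 0) :
    (fun p : ℕ => βc p - (1 + √(2 / ((p : ℝ) * Real.pi)))) =o[atTop]
      (fun p : ℕ => 1 / √(p : ℝ)) := by
  -- Reindexing by `p = m + 2` matches the scale `1/√(m+2)`.
  rw [← map_add_atTop_eq_nat 2, isLittleO_map, isLittleO_iff]
  intro ε hε
  filter_upwards [eventually_rbSlope_pos (lt_add_of_pos_right √(2 / Real.pi) hε),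
    eventually_rbSlope_neg (sub_lt_self √(2 / Real.pi) hε), eventually_ge_atTop 2]
    with m h1 h2 hm
  have h0 := h (m + 1) (by omega)
  have hmono := rbSlope_strictMono (m + 1) (by omega)
  rw [← h0, hmono.lt_iff_lt] at h1 h2
  have hs : 0 < 1 / √((m : ℝ) + 2) := by positivity
  have e : √(2 / (((m + 2 : ℕ) : ℝ) * Real.pi)) = √(2 / Real.pi) * (1 / √((m : ℝ) + 2)) := by
    rw [← Real.sqrt_one, ← Real.sqrt_div zero_le_one, ← Real.sqrt_mul (by positivity)]
    congr 1
    push_cast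
    field_simp
  simp only [Function.comp_apply, e, Real.norm_eq_abs]
  push_cast
  rw [abs_of_pos hs, abs_le]
  constructor <;> nlinarith

/-! ### Scalar autonomous equations -/

/-- A vector field on `[-1, 1]` that is Lipschitz, bounded, and points inwards at both ends. -/
structure InwardField (F : ℝ → ℝ) (K L : ℝ≥0) : Prop where
  lipschitz : LipschitzOnWith K F (Icc (-1) 1)
  bound : ∀ x ∈ Icc (-1 : ℝ) 1, |F x| ≤ L
  right : F 1 < 0
  left : 0 < F (-1)

namespace SolvesODE

variable {F G : ℝ → ℝ} {x y : ℝ≥0 → ℝ}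

theorem hasDerivWithinAt (h : SolvesODE F x) {t : ℝ} (ht : 0 ≤ t) :
    HasDerivWithinAt (fun s : ℝ => x s.toNNReal) (F (x t.toNNReal)) (Ici 0) t := by
  have := h t.toNNReal
  rwa [Real.coe_toNNReal t ht] at this

theorem hasDerivWithinAt_Ici (h : SolvesODE F x) {t : ℝ} (ht : 0 ≤ t) :
    HasDerivWithinAt (fun s : ℝ => x s.toNNReal) (F (x t.toNNReal)) (Ici t) t :=
  (h.hasDerivWithinAt ht).mono (Ici_subset_Ici.2 ht)

theorem hasDerivAt (h : SolvesODE F x) {t : ℝ} (ht : 0 < t) :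
    HasDerivAt (fun s : ℝ => x s.toNNReal) (F (x t.toNNReal)) t :=
  (h.hasDerivWithinAt ht.le).hasDerivAt (Ici_mem_nhds ht)

theorem continuousOn (h : SolvesODE F x) : ContinuousOn (fun s : ℝ => x s.toNNReal) (Ici 0) :=
  fun _ ht => (h.hasDerivWithinAt ht).continuousWithinAt

theorem continuousOn_Icc (h : SolvesODE F x) {a : ℝ} (ha : 0 ≤ a) (b : ℝ) :
    ContinuousOn (fun s : ℝ => x s.toNNReal) (Icc a b) :=
  h.continuousOn.mono fun _ ht => ha.trans ht.1

theorem continuous (h : SolvesODE F x) : Continuous x := by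
  have : x = (Ici (0 : ℝ)).domRestrict fun s : ℝ => x s.toNNReal := by
    funext t
    change x t = x (Real.toNNReal (t : ℝ))
    rw [Real.toNNReal_coe]
  rw [this]
  exact continuousOn_iff_continuous_domRestrict.1 h.continuousOn

theorem congr (h : SolvesODE F x) (H : ∀ t, F (x t) = G (x t)) : SolvesODE G x :=
  fun t => by rw [← H]; exact h t

theorem neg (h : SolvesODE F x) : SolvesODE (fun z => -F (-z)) (fun t => -x t) := fun t => by
  have := (h t).neg
  rw [← neg_neg (x t)] at this
  exact this

/-- A constant barrier: at each contact with the level `c` the solution is strictly decreasing, so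
it cannot cross upwards. -/
theorem le_of_neg (h : SolvesODE F x) {c : ℝ} (hc : F c < 0) (h0 : x 0 ≤ c) (t : ℝ≥0) :
    x t ≤ c := by
  have := image_le_of_deriv_right_lt_deriv_boundary (a := 0) (b := t) (B := fun _ => c)
    (B' := fun _ => 0) (h.continuousOn_Icc le_rfl t)
    (fun s hs => h.hasDerivWithinAt_Ici hs.1) (by simpa using h0)
    (fun s => hasDerivAt_const s c) (fun s _ hs => by rw [hs]; exact hc)
    (right_mem_Icc.2 t.2)
  simpa using this

theorem ge_of_pos (h : SolvesODE F x) {c : ℝ} (hc : 0 < F c) (h0 : c ≤ x 0) (t : ℝ≥0) :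
    c ≤ x t := by
  have := h.neg.le_of_neg (c := -c) (by simpa using hc) (neg_le_neg h0) t
  exact neg_le_neg_iff.1 this

theorem mem_Icc {K L : ℝ≥0} (h : SolvesODE F x) (hF : InwardField F K L)
    (h0 : x 0 ∈ Icc (-1 : ℝ) 1) (t : ℝ≥0) : x t ∈ Icc (-1 : ℝ) 1 :=
  ⟨h.ge_of_pos hF.left h0.1 t, h.le_of_neg hF.right h0.2 t⟩

theorem abs_sub_le {K : ℝ≥0} {s : Set ℝ} (hK : LipschitzOnWith K F s) (hx : SolvesODE F x)
    (hy : SolvesODE F y) (hxs : ∀ t, x t ∈ s) (hys : ∀ t, y t ∈ s) (t : ℝ≥0) :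
    |x t - y t| ≤ |x 0 - y 0| * Real.exp (K * t) := by
  have := dist_le_of_trajectories_ODE_of_mem (v := fun _ => F) (s := fun _ => s) (a := 0) (b := t)
    (K := K) (δ := |x 0 - y 0|) (fun _ _ => hK) (hx.continuousOn_Icc le_rfl t)
    (fun r hr => hx.hasDerivWithinAt_Ici hr.1) (fun r _ => hxs _) (hy.continuousOn_Icc le_rfl t)
    (fun r hr => hy.hasDerivWithinAt_Ici hr.1) (fun r _ => hys _)
    (by simp [Real.dist_eq]) t (right_mem_Icc.2 t.2)
  simpa [Real.dist_eq] using this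

theorem eq_of_inward {K L : ℝ≥0} (hF : InwardField F K L) (hx : SolvesODE F x)
    (hy : SolvesODE F y) (h0 : x 0 ∈ Icc (-1 : ℝ) 1) (hxy : y 0 = x 0) : y = x := by
  funext t
  have := abs_sub_le hF.lipschitz hy hx (hy.mem_Icc hF (hxy ▸ h0)) (hx.mem_Icc hF h0) t
  rw [hxy, sub_self, abs_zero, zero_mul] at this
  exact sub_eq_zero.1 (abs_nonpos_iff.1 this)

theorem abs_sub_le_mul {K L : ℝ≥0} (hF : InwardField F K L) (hx : SolvesODE F x)
    (h0 : x 0 ∈ Icc (-1 : ℝ) 1) {s t : ℝ≥0} (hst : s ≤ t) :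
    |x t - x s| ≤ L * (t - s) := by
  have := norm_image_sub_le_of_norm_deriv_right_le_segment (a := (s : ℝ)) (b := t) (C := L)
    (hx.continuousOn_Icc s.2 t) (fun r hr => hx.hasDerivWithinAt_Ici (s.2.trans hr.1))
    (fun r _ => hF.bound _ (hx.mem_Icc hF h0 _)) t (right_mem_Icc.2 hst)
  simpa using this

/-- The Euler error over one step. The path moves at speed at most `L`, so `F` along it varies by at
most `K L (t - s)`; no second derivative is needed. -/
theorem abs_taylor_le {K L : ℝ≥0} (hF : InwardField F K L) (hx : SolvesODE F x)
    (h0 : x 0 ∈ Icc (-1 : ℝ) 1) {s t : ℝ≥0} (hst : s ≤ t) :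
    |x t - x s - F (x s) * (t - s)| ≤ K * L * (t - s) ^ 2 := by
  have hst' : (s : ℝ) ≤ t := hst
  have := norm_image_sub_le_of_norm_deriv_right_le_segment (a := (s : ℝ)) (b := t)
    (f := fun r : ℝ => x r.toNNReal - F (x s) * r) (f' := fun r => F (x r.toNNReal) - F (x s))
    (C := K * (L * (t - s)))
    ((hx.continuousOn_Icc s.2 t).sub (by fun_prop)) (fun r hr => ?_)
    (fun r hr => ?_) t (right_mem_Icc.2 hst)
  · simp only [Real.toNNReal_coe, Real.norm_eq_abs] at this
    convert this using 1
    · congr 1; ring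
    · ring
  · have := (hx.hasDerivWithinAt_Ici (s.2.trans hr.1)).sub
      ((hasDerivAt_id r).const_mul (F (x s))).hasDerivWithinAt
    rw [mul_one] at this
    exact this
  · have hsr : s ≤ r.toNNReal := NNReal.le_toNNReal_of_coe_le hr.1
    have h1 := hF.lipschitz.dist_le_mul _ (hx.mem_Icc hF h0 r.toNNReal) _ (hx.mem_Icc hF h0 s)
    have h2 := hx.abs_sub_le_mul hF h0 hsr
    rw [Real.coe_toNNReal r (s.2.trans hr.1)] at h2
    rw [Real.dist_eq, Real.dist_eq] at h1
    refine h1.trans (mul_le_mul_of_nonneg_left (h2.trans ?_) K.2)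
    exact mul_le_mul_of_nonneg_left (by linarith [hr.2]) L.2

end SolvesODE

/-- A bounded Lipschitz vector field has a global solution from every initial value. -/
theorem exists_solvesODE_of_lipschitz {G : ℝ → ℝ} {K L : ℝ≥0} (hK : LipschitzWith K G)
    (hL : ∀ x, |G x| ≤ L) (x₀ : ℝ) : ∃ x : ℝ≥0 → ℝ, x 0 = x₀ ∧ SolvesODE G x := by
  have hex : ∀ n : ℕ, ∃ α : ℝ → ℝ, α 0 = x₀ ∧
      ∀ t ∈ Icc (0 : ℝ) n, HasDerivWithinAt α (G (α t)) (Icc 0 (n : ℝ)) t := fun n => by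
    have hP : IsPicardLindelof (fun _ : ℝ => G) (⟨0, by simp⟩ : Icc (0 : ℝ) n) x₀ (L * n) 0 L K :=
      ⟨fun _ _ => hK.lipschitzOnWith, fun _ _ => continuousOn_const, fun _ _ x _ => hL x, by simp⟩
    exact hP.exists_eq_forall_mem_Icc_hasDerivWithinAt₀
  choose α hα0 hα using hex
  have hcont : ∀ n, ContinuousOn (α n) (Icc 0 (n : ℝ)) :=
    fun n t ht => (hα n t ht).continuousWithinAt
  have hright : ∀ n : ℕ, ∀ t ∈ Ico (0 : ℝ) n, HasDerivWithinAt (α n) (G (α n t)) (Ici t) t :=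
    fun n t ht => (hα n t (Ico_subset_Icc_self ht)).mono_of_mem_nhdsWithin
      (Icc_mem_nhdsGE_of_mem ht)
  have heq : ∀ n m : ℕ, n ≤ m → EqOn (α n) (α m) (Icc 0 n) := fun n m hnm => by
    have hnm' : (n : ℝ) ≤ m := by exact_mod_cast hnm
    exact ODE_solution_unique_of_mem_Icc_right (v := fun _ => G) (s := fun _ => univ) (K := K)
      (fun _ _ => hK.lipschitzOnWith) (hcont n) (hright n) (fun _ _ => mem_univ _)
      ((hcont m).mono (Icc_subset_Icc_right hnm'))
      (fun t ht => hright m t ⟨ht.1, ht.2.trans_le hnm'⟩) (fun _ _ => mem_univ _)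
      (by rw [hα0, hα0])
  -- The solutions on `[0, n]` agree by uniqueness. The `+ 1` makes `t < n`, so the chosen solution
  -- lives on a neighbourhood of `t` in `[0, ∞)`.
  refine ⟨fun t => α (⌊(t : ℝ)⌋₊ + 1) t, by simp [hα0], fun t => ?_⟩
  set n := ⌊(t : ℝ)⌋₊ + 1 with hn
  have htn : (t : ℝ) < n := by rw [hn]; push_cast; exact Nat.lt_floor_add_one _
  have hmem : Icc 0 (n : ℝ) ∈ 𝓝[Ici 0] (t : ℝ) :=
    inter_mem self_mem_nhdsWithin (mem_nhdsWithin_of_mem_nhds (Iic_mem_nhds htn))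
  have hlt : Iio (n : ℝ) ∈ 𝓝[Ici 0] (t : ℝ) := mem_nhdsWithin_of_mem_nhds (Iio_mem_nhds htn)
  refine ((hα n t ⟨t.2, htn.le⟩).mono_of_mem_nhdsWithin hmem).congr_of_eventuallyEq ?_ ?_
  · filter_upwards [self_mem_nhdsWithin, hlt] with s hs hsn
    have hs' : (s.toNNReal : ℝ) = s := Real.coe_toNNReal s hs
    simp only [hs']
    refine heq _ _ ?_ ⟨hs, ?_⟩
    · rw [Nat.succ_le_iff, Nat.floor_lt hs]
      exact hsn
    · push_cast
      exact (Nat.lt_floor_add_one _).le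
  · simp [hn]

theorem InwardField.exists_solvesODE {F : ℝ → ℝ} {K L : ℝ≥0} (hF : InwardField F K L) {x₀ : ℝ}
    (h0 : x₀ ∈ Icc (-1 : ℝ) 1) :
    ∃ x : ℝ≥0 → ℝ, x 0 = x₀ ∧ SolvesODE F x ∧ ∀ t, x t ∈ Icc (-1 : ℝ) 1 := by
  have h11 : (-1 : ℝ) ≤ 1 := by norm_num
  -- Clamping makes the field bounded and globally Lipschitz; the barriers at `±1` keep its solution
  -- where it coincides with `F`.
  set G : ℝ → ℝ := fun z => F (projIcc (-1) 1 h11 z)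
  have hGF : ∀ z ∈ Icc (-1 : ℝ) 1, G z = F z := fun z hz => by
    simp only [G, projIcc_of_mem h11 hz]
  have hG : LipschitzWith K G := by
    have := hF.lipschitz.to_restrict.comp (LipschitzWith.projIcc h11)
    rwa [mul_one] at this
  obtain ⟨x, hx0, hx⟩ := exists_solvesODE_of_lipschitz hG (fun z => hF.bound _ (Subtype.mem _)) x₀
  have hGI : InwardField G K L := by
    refine ⟨hG.lipschitzOnWith, fun z _ => hF.bound _ (Subtype.mem _), ?_, ?_⟩
    · rw [hGF 1 (by simp)]; exact hF.right
    · rw [hGF (-1) (by simp)]; exact hF.left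
  have hmem := hx.mem_Icc hGI (hx0 ▸ h0)
  exact ⟨x, hx0, hx.congr fun t => hGF _ (hmem t), hmem⟩

/-! ### Stability -/

theorem exists_sub_mul_le_of_hasDerivAt {F : ℝ → ℝ} {c d : ℝ} (h : HasDerivAt F d c)
    (hc : F c = 0) (hd : d < 0) :
    ∃ r > 0, ∃ l > 0, ∀ z, |z - c| ≤ r → F z * (z - c) ≤ -l * (z - c) ^ 2 := by
  have h1 := (hasDerivAt_iff_isLittleO.1 h).bound (neg_pos.2 (by linarith : d / 2 < 0))
  obtain ⟨r, hr, hb⟩ := Metric.eventually_nhds_iff_ball.1 h1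
  refine ⟨r / 2, half_pos hr, -d / 2, by linarith, fun z hz => ?_⟩
  have := hb z (by rw [Metric.mem_ball, Real.dist_eq]; linarith)
  rw [hc, sub_zero, smul_eq_mul, Real.norm_eq_abs, Real.norm_eq_abs] at this
  have h2 : (F z - (z - c) * d) * (z - c) ≤ -(d / 2) * (z - c) ^ 2 := by
    calc _ ≤ |F z - (z - c) * d| * |z - c| := by rw [← abs_mul]; exact le_abs_self _
      _ ≤ -(d / 2) * |z - c| * |z - c| := mul_le_mul_of_nonneg_right this (abs_nonneg _)
      _ = _ := by rw [mul_assoc, abs_mul_abs_self]; ring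
  linarith

/-- The inequality `H` forces `F` to point strictly inwards at `c ± ρ`, so both ends are barriers.
-/
theorem SolvesODE.abs_sub_le_of_inward {F : ℝ → ℝ} {c r l : ℝ} (hl : 0 < l)
    (H : ∀ z, |z - c| ≤ r → F z * (z - c) ≤ -l * (z - c) ^ 2) {x : ℝ≥0 → ℝ}
    (hx : SolvesODE F x) {ρ : ℝ} (hρ : 0 < ρ) (hρr : ρ ≤ r) (h0 : |x 0 - c| ≤ ρ) (t : ℝ≥0) :
    |x t - c| ≤ ρ := by
  have h1 : F (c + ρ) < 0 := by
    have := H (c + ρ) (by simpa [abs_of_pos hρ] using hρr)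
    have h2 : F (c + ρ) * ρ ≤ -l * ρ ^ 2 := by simpa using this
    by_contra hc
    nlinarith [mul_nonneg (not_lt.1 hc) hρ.le, mul_pos hl (pow_pos hρ 2)]
  have h2 : 0 < F (c - ρ) := by
    have := H (c - ρ) (by simpa [abs_of_pos hρ] using hρr)
    have h2 : F (c - ρ) * (-ρ) ≤ -l * ρ ^ 2 := by simpa using this
    by_contra hc
    nlinarith [mul_nonneg (neg_nonneg.2 (not_lt.1 hc)) hρ.le, mul_pos hl (pow_pos hρ 2)]
  rw [abs_le] at h0 ⊢
  have h3 := hx.le_of_neg h1 (by linarith [h0.2]) t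
  have h4 := hx.ge_of_pos h2 (by linarith [h0.1]) t
  constructor <;> linarith

/-- The Lyapunov quantity. A bound of `F z * (z - c)` by a multiple of `(z - c)²` fixes the sign of
its derivative: `l > 0` yields decay near a stable point, and `-l` yields growth near an unstable
one. -/
theorem SolvesODE.hasDerivAt_sq_mul_exp {F : ℝ → ℝ} {x : ℝ≥0 → ℝ} (hx : SolvesODE F x)
    (c l : ℝ) {t : ℝ} (ht : 0 < t) :
    HasDerivAt (fun s : ℝ => (x s.toNNReal - c) ^ 2 * Real.exp (2 * l * s))
      (2 * (F (x t.toNNReal) * (x t.toNNReal - c) + l * (x t.toNNReal - c) ^ 2)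
        * Real.exp (2 * l * t)) t := by
  refine ((((hx.hasDerivAt ht).sub_const c).pow 2).mul
    (((hasDerivAt_id t).const_mul (2 * l)).exp)).congr_deriv ?_
  simp only [id, Pi.pow_apply]
  push_cast
  ring

theorem SolvesODE.continuousOn_sq_mul_exp {F : ℝ → ℝ} {x : ℝ≥0 → ℝ} (hx : SolvesODE F x)
    (c l : ℝ) :
    ContinuousOn (fun s : ℝ => (x s.toNNReal - c) ^ 2 * Real.exp (2 * l * s)) (Ici 0) :=
  ((hx.continuousOn.sub continuousOn_const).pow 2).mul (by fun_prop)

theorem isAsymptoticallyStable_of_hasDerivAt_neg {F : ℝ → ℝ} {c d : ℝ} (h : HasDerivAt F d c)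
    (hc : F c = 0) (hd : d < 0) : IsAsymptoticallyStable F c := by
  obtain ⟨r, hr, l, hl, H⟩ := exists_sub_mul_le_of_hasDerivAt h hc hd
  constructor
  · intro ε hε
    refine ⟨min (ε / 2) r, lt_min (half_pos hε) hr, fun x hx h0 t => ?_⟩
    have := hx.abs_sub_le_of_inward hl H (lt_min (half_pos hε) hr) (min_le_right _ _) h0.le t
    linarith [min_le_left (ε / 2) r]
  · refine ⟨r, hr, fun x hx h0 => ?_⟩
    have hin := hx.abs_sub_le_of_inward hl H hr le_rfl h0.le
    have hanti : AntitoneOn (fun s : ℝ => (x s.toNNReal - c) ^ 2 * Real.exp (2 * l * s))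
        (Ici 0) := by
      refine antitoneOn_of_deriv_nonpos (convex_Ici 0) (hx.continuousOn_sq_mul_exp c l)
        (fun t ht => ?_) fun t ht => ?_
      · rw [interior_Ici] at ht
        exact (hx.hasDerivAt_sq_mul_exp c l ht).differentiableAt.differentiableWithinAt
      · rw [interior_Ici] at ht
        rw [(hx.hasDerivAt_sq_mul_exp c l ht).deriv]
        have := H _ (hin t.toNNReal)
        exact mul_nonpos_of_nonpos_of_nonneg (by linarith) (Real.exp_pos _).le
    have hdecay : ∀ t : ℝ≥0, (x t - c) ^ 2 ≤ (x 0 - c) ^ 2 * Real.exp (-(2 * l * t)) := by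
      intro t
      have := hanti self_mem_Ici (mem_Ici.2 t.2) t.2
      simp only [Real.toNNReal_zero, mul_zero, Real.exp_zero, mul_one, NNReal.val_eq_coe,
        Real.toNNReal_coe] at this
      rw [Real.exp_neg, ← div_eq_mul_inv, le_div_iff₀ (Real.exp_pos _)]
      exact this
    have hlim : Tendsto (fun t : ℝ≥0 => (x 0 - c) ^ 2 * Real.exp (-(2 * l * t))) atTop (𝓝 0) := by
      rw [← mul_zero ((x 0 - c) ^ 2)]
      refine Tendsto.const_mul _ (Real.tendsto_exp_neg_atTop_nhds_zero.comp ?_)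
      exact NNReal.tendsto_coe_atTop.2 tendsto_id |>.const_mul_atTop (by positivity)
    have hsq := squeeze_zero (fun t => sq_nonneg (x t - c)) hdecay hlim
    have habs : Tendsto (fun t => |x t - c|) atTop (𝓝 0) := by
      have := (Real.continuous_sqrt.tendsto 0).comp hsq
      rw [Real.sqrt_zero] at this
      exact this.congr fun t => Real.sqrt_sq_eq_abs _
    exact tendsto_sub_nhds_zero_iff.1 (tendsto_zero_iff_abs_tendsto_zero _ |>.2 habs)

theorem isUnstable_of_hasDerivAt_pos {F : ℝ → ℝ} {K L : ℝ≥0} (hF : InwardField F K L) {d : ℝ}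
    (h : HasDerivAt F d 0) (hc : F 0 = 0) (hd : 0 < d) : IsUnstable F 0 := by
  intro hst
  obtain ⟨r, hr, l, hl, H⟩ := exists_sub_mul_le_of_hasDerivAt h.neg (c := 0) (by simp [hc])
    (neg_neg_of_pos hd)
  obtain ⟨δ, hδ, hst⟩ := hst r hr
  -- The initial value must be nonzero, within `δ` of `0`, and inside `[-1, 1]`, where existence of
  -- a global solution is known.
  have hpos : 0 < min (δ / 2) 1 := lt_min (half_pos hδ) one_pos
  obtain ⟨x, hx0, hx, -⟩ := hF.exists_solvesODE (x₀ := min (δ / 2) 1)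
    ⟨by linarith, min_le_right _ _⟩
  have hin := hst x hx (by
    rw [hx0, sub_zero, abs_of_pos hpos]; linarith [min_le_left (δ / 2) 1])
  have hmono : MonotoneOn (fun s : ℝ => (x s.toNNReal - 0) ^ 2 * Real.exp (2 * (-l) * s))
      (Ici 0) := by
    refine monotoneOn_of_deriv_nonneg (convex_Ici 0) (hx.continuousOn_sq_mul_exp 0 (-l))
      (fun t ht => ?_) fun t ht => ?_
    · rw [interior_Ici] at ht
      exact (hx.hasDerivAt_sq_mul_exp 0 (-l) ht).differentiableAt.differentiableWithinAt
    · rw [interior_Ici] at ht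
      rw [(hx.hasDerivAt_sq_mul_exp 0 (-l) ht).deriv]
      have := H _ (hin t.toNNReal).le
      simp only [Pi.neg_apply] at this
      exact mul_nonneg (by linarith) (Real.exp_pos _).le
  have hgrow : ∀ t : ℝ≥0, (x 0) ^ 2 * Real.exp (2 * l * t) ≤ r ^ 2 := by
    intro t
    have := hmono self_mem_Ici (mem_Ici.2 t.2) t.2
    simp only [Real.toNNReal_zero, mul_zero, Real.exp_zero, mul_one, NNReal.val_eq_coe,
      Real.toNNReal_coe, sub_zero] at this
    rw [mul_neg, neg_mul, Real.exp_neg, ← div_eq_mul_inv, le_div_iff₀ (Real.exp_pos _)] at this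
    have h2 := hin t
    rw [sub_zero] at h2
    exact this.trans (sq_le_sq.2 (by rw [abs_of_pos hr]; exact h2.le))
  have hlim : Tendsto (fun t : ℝ≥0 => (x 0) ^ 2 * Real.exp (2 * l * t)) atTop atTop := by
    refine Tendsto.const_mul_atTop (by rw [hx0]; positivity) (Real.tendsto_exp_atTop.comp ?_)
    exact NNReal.tendsto_coe_atTop.2 tendsto_id |>.const_mul_atTop (by positivity)
  obtain ⟨t, ht⟩ := (hlim.eventually (eventually_gt_atTop (r ^ 2))).exists
  exact absurd (hgrow t) (not_le.2 ht)

/-! ### The drift points inwards -/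

/-- At `m = 1` the `S₁` terms cancel and leave `-2 S₂`, in which only `k = 0` survives. At `m = -1`
it is `2 S₁`, with only `k = p - 1`. -/
theorem rbDrift_one_neg (p : ℕ) (hp : 1 ≤ p) (β : ℝ) : rbDrift p β 1 < 0 := by
  have h : 0 < rbS2 p β 1 := by
    refine Finset.sum_pos' (fun k _ => by norm_num; positivity)
      ⟨0, Finset.mem_range.2 (by omega), ?_⟩
    norm_num
    positivity
  unfold rbDrift
  linarith

theorem rbDrift_neg_one_pos (p : ℕ) (hp : 1 ≤ p) (β : ℝ) : 0 < rbDrift p β (-1) := by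
  have h : 0 < rbS1 p β (-1) := by
    refine Finset.sum_pos' (fun k _ => by norm_num; positivity)
      ⟨p - 1, Finset.mem_range.2 (by omega), ?_⟩
    norm_num
    positivity
  unfold rbDrift
  linarith

theorem exists_inwardField_rbDrift (p : ℕ) (hp : 1 ≤ p) (β : ℝ) :
    ∃ K L : ℝ≥0, InwardField (rbDrift p β) K L := by
  have hc := contDiff_rbDrift p β
  obtain ⟨K, hK⟩ := (hc.locallyLipschitz.locallyLipschitzOn
    (s := Icc (-1) 1)).exists_lipschitzOnWith_of_compact isCompact_Icc
  obtain ⟨C, hC⟩ := isCompact_Icc.exists_bound_of_continuousOn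
    (hc.continuous.continuousOn (s := Icc (-1 : ℝ) 1))
  exact ⟨K, C.toNNReal, hK, fun x hx => (hC x hx).trans (Real.le_coe_toNNReal C),
    rbDrift_one_neg p hp β, rbDrift_neg_one_pos p hp β⟩

/-! ### Hypergeometric and binomial weights -/

theorem abs_descFactorial_div_sub_pow_le {N a : ℕ} (hN : 0 < N) (ha : a ≤ N) {u : ℝ}
    (hu : u ∈ Icc (0 : ℝ) 1) (hau : |(a : ℝ) / N - u| ≤ 1 / N) (k : ℕ) :
    |(a.descFactorial k : ℝ) / (N : ℝ) ^ k - u ^ k| ≤ k * (k + 1) / N := by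
  have hN' : (0 : ℝ) < N := by exact_mod_cast hN
  induction k with
  | zero => simp
  | succ k ih =>
    have hx0 : (0 : ℝ) ≤ ((a - k : ℕ) : ℝ) / N := by positivity
    have hx1 : ((a - k : ℕ) : ℝ) / N ≤ 1 := by
      rw [div_le_one hN']
      exact_mod_cast (Nat.sub_le a k).trans ha
    have hxu : |((a - k : ℕ) : ℝ) / N - u| ≤ (k + 1) / N := by
      rw [abs_le] at hau ⊢
      obtain ⟨h1, h2⟩ := hau
      have e1 : ((a - k : ℕ) : ℝ) / N ≤ (a : ℝ) / N := by
        gcongr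
        exact_mod_cast Nat.sub_le a k
      have e2 : (a : ℝ) / N ≤ ((a - k : ℕ) : ℝ) / N + k / N := by
        rw [← add_div]
        gcongr
        exact_mod_cast (by omega : a ≤ a - k + k)
      have e3 : ((k : ℝ) + 1) / N = k / N + 1 / N := add_div _ _ _
      have e4 : (0 : ℝ) ≤ k / N := by positivity
      constructor <;> linarith
    have huk : u ^ k ∈ Icc (0 : ℝ) 1 := ⟨pow_nonneg hu.1 k, pow_le_one₀ hu.1 hu.2⟩
    have e : ((a.descFactorial (k + 1) : ℕ) : ℝ) / (N : ℝ) ^ (k + 1) - u ^ (k + 1)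
        = ((a - k : ℕ) : ℝ) / N * ((a.descFactorial k : ℝ) / (N : ℝ) ^ k - u ^ k)
          + u ^ k * (((a - k : ℕ) : ℝ) / N - u) := by
      rw [Nat.descFactorial_succ]
      push_cast
      field_simp
      ring
    rw [e]
    refine (abs_add_le _ _).trans ?_
    rw [abs_mul, abs_mul, abs_of_nonneg hx0, abs_of_nonneg huk.1]
    have s1 := mul_le_mul hx1 ih (abs_nonneg _) zero_le_one
    have s2 := mul_le_mul huk.2 hxu (abs_nonneg _) zero_le_one
    refine (add_le_add s1 s2).trans ?_
    rw [one_mul, one_mul, ← add_div]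
    gcongr
    push_cast
    nlinarith [(Nat.cast_nonneg k : (0 : ℝ) ≤ k)]

/-- A hypergeometric weight is a quotient of falling factorials, each close to a power after
division by the matching power of `N`. The population has `N - 1` members because the selected site
is excluded, hence `a + b + 1 = N` and the tolerances `1/N`. -/
theorem abs_hypergeometric_sub_le {N a b n k : ℕ} (hk : k ≤ n) (hn : n + 1 ≤ N)
    (hab : a + b + 1 = N) {u v : ℝ} (hu : u ∈ Icc (0 : ℝ) 1) (hv : v ∈ Icc (0 : ℝ) 1)
    (hau : |(a : ℝ) / N - u| ≤ 1 / N) (hbv : |(b : ℝ) / N - v| ≤ 1 / N) :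
    |((a.choose k * b.choose (n - k) : ℕ) : ℝ) / ((a + b).choose n : ℕ)
      - n.choose k * (u ^ k * v ^ (n - k))| ≤ 3 * 2 ^ n * (n * (n + 1)) / N := by
  have hN : 0 < N := by omega
  have hN' : (0 : ℝ) < N := by exact_mod_cast hN
  have hpos : (0 : ℝ) < ((a + b).choose n : ℕ) := by
    exact_mod_cast Nat.choose_pos (by omega)
  set T : ℝ := ((a.choose k * b.choose (n - k) : ℕ) : ℝ) / ((a + b).choose n : ℕ) with hT
  have hT0 : 0 ≤ T := by positivity
  have hT1 : T ≤ 1 := by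
    rw [hT, div_le_one hpos, Nat.add_choose_eq]
    exact_mod_cast Finset.single_le_sum (f := fun ij : ℕ × ℕ => a.choose ij.1 * b.choose ij.2)
      (fun _ _ => Nat.zero_le _) (a := (k, n - k)) (by simp; omega)
  set α : ℝ := (a.descFactorial k : ℝ) / (N : ℝ) ^ k with hα
  set α' : ℝ := (b.descFactorial (n - k) : ℝ) / (N : ℝ) ^ (n - k) with hα'
  set γ : ℝ := ((a + b).descFactorial n : ℝ) / (N : ℝ) ^ n with hγ
  have h1 := abs_descFactorial_div_sub_pow_le hN (by omega : a ≤ N) hu hau k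
  have h2 := abs_descFactorial_div_sub_pow_le hN (by omega : b ≤ N) hv hbv (n - k)
  have h3 := abs_descFactorial_div_sub_pow_le hN (by omega : a + b ≤ N)
    (u := 1) (by simp) (by
      have : ((a + b : ℕ) : ℝ) = N - 1 := by rw [← hab]; push_cast; ring
      rw [this, sub_div, div_self hN'.ne', sub_sub_cancel_left, abs_neg,
        abs_of_pos (by positivity)]) n
  rw [one_pow] at h3
  have hmono : ∀ j : ℕ, j ≤ n → (j : ℝ) * (j + 1) / N ≤ n * (n + 1) / N := fun j hj => by
    have : (j : ℝ) ≤ n := by exact_mod_cast hj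
    gcongr
  have h1' := h1.trans (hmono k hk)
  have h2' := h2.trans (hmono (n - k) (by omega))
  rw [← hα] at h1'
  rw [← hα'] at h2'
  rw [← hγ] at h3
  set ε : ℝ := n * (n + 1) / N with hε
  -- Since `γ` is close to `1` and `T ≤ 1`, this product form avoids estimating a quotient.
  have hid : T * γ = n.choose k * (α * α') := by
    rw [hT, hγ, hα, hα', Nat.descFactorial_eq_factorial_mul_choose,
      Nat.descFactorial_eq_factorial_mul_choose, Nat.descFactorial_eq_factorial_mul_choose]
    have hf : (n.factorial : ℝ) = n.choose k * (k.factorial * (n - k).factorial) := by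
      rw [← Nat.choose_mul_factorial_mul_factorial hk]; push_cast; ring
    have hNn : (N : ℝ) ^ n = N ^ k * N ^ (n - k) := by rw [← pow_add, Nat.add_sub_cancel' hk]
    push_cast
    rw [hf, hNn]
    field_simp
  have hα1 : α ∈ Icc (0 : ℝ) 1 := by
    refine ⟨by positivity, ?_⟩
    rw [hα, div_le_one (by positivity)]
    have : (a.descFactorial k : ℝ) ≤ (a : ℝ) ^ k := by exact_mod_cast Nat.descFactorial_le_pow a k
    refine this.trans (pow_le_pow_left₀ (Nat.cast_nonneg _) ?_ k)
    exact_mod_cast (by omega : a ≤ N)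
  have hvp : v ^ (n - k) ∈ Icc (0 : ℝ) 1 := ⟨pow_nonneg hv.1 _, pow_le_one₀ hv.1 hv.2⟩
  have hprod : |α * α' - u ^ k * v ^ (n - k)| ≤ 2 * ε := by
    have : α * α' - u ^ k * v ^ (n - k)
        = α * (α' - v ^ (n - k)) + v ^ (n - k) * (α - u ^ k) := by ring
    rw [this]
    refine (abs_add_le _ _).trans ?_
    rw [abs_mul, abs_mul, abs_of_nonneg hα1.1, abs_of_nonneg hvp.1]
    have s1 := mul_le_mul hα1.2 h2' (abs_nonneg _) zero_le_one
    have s2 := mul_le_mul hvp.2 h1' (abs_nonneg _) zero_le_one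
    linarith
  have hC : (n.choose k : ℝ) ≤ 2 ^ n := by exact_mod_cast Nat.choose_le_two_pow n k
  have h2n : (1 : ℝ) ≤ 2 ^ n := one_le_pow₀ (by norm_num)
  have hε0 : 0 ≤ ε := by positivity
  have e : T - n.choose k * (u ^ k * v ^ (n - k))
      = -(T * (γ - 1)) + n.choose k * (α * α' - u ^ k * v ^ (n - k)) := by
    linear_combination hid
  rw [e]
  refine (abs_add_le _ _).trans ?_
  rw [abs_neg, abs_mul, abs_mul, abs_of_nonneg hT0, Nat.abs_cast]
  have s1 : T * |γ - 1| ≤ 2 ^ n * ε :=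
    mul_le_mul (hT1.trans h2n) h3 (abs_nonneg _) (by positivity)
  have s2 : (n.choose k : ℝ) * |α * α' - u ^ k * v ^ (n - k)| ≤ 2 ^ n * (2 * ε) :=
    mul_le_mul hC hprod (abs_nonneg _) (by positivity)
  have : 3 * 2 ^ n * ((n : ℝ) * (n + 1)) / N = 2 ^ n * ε + 2 ^ n * (2 * ε) := by
    rw [hε]; ring
  rw [this]
  exact add_le_add s1 s2

theorem card_filter_powersetCard {ι : Type*} [DecidableEq ι] (T : Finset ι) (q : ι → Prop)
    [DecidablePred q] {n k : ℕ} (hk : k ≤ n) :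
    ((T.powersetCard n).filter fun D => (D.filter q).card = k).card
      = (T.filter q).card.choose k * (T.filter fun j => ¬q j).card.choose (n - k) := by
  rw [← Finset.card_powersetCard, ← Finset.card_powersetCard, ← Finset.card_product]
  refine Finset.card_bij' (fun D _ => (D.filter q, D.filter fun j => ¬q j))
    (fun XY _ => XY.1 ∪ XY.2) ?_ ?_ ?_ ?_
  · intro D hD
    simp only [Finset.mem_filter, Finset.mem_powersetCard] at hD
    simp only [Finset.mem_product, Finset.mem_powersetCard]
    have := Finset.card_filter_add_card_filter_not (s := D) q
    exact ⟨⟨Finset.filter_subset_filter _ hD.1.1, hD.2⟩,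
      Finset.filter_subset_filter _ hD.1.1, by omega⟩
  · rintro ⟨X, Y⟩ h
    simp only [Finset.mem_product, Finset.mem_powersetCard] at h
    obtain ⟨⟨hX, hXc⟩, hY, hYc⟩ := h
    have hXq : ∀ j ∈ X, j ∈ T ∧ q j := fun j hj => Finset.mem_filter.1 (hX hj)
    have hYq : ∀ j ∈ Y, j ∈ T ∧ ¬q j := fun j hj => Finset.mem_filter.1 (hY hj)
    have hdisj : Disjoint X Y := Finset.disjoint_left.2 fun j h1 h2 => (hYq j h2).2 (hXq j h1).2
    have hf : (X ∪ Y).filter q = X := by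
      ext j
      simp only [Finset.mem_filter, Finset.mem_union]
      exact ⟨fun h => h.1.resolve_right fun h' => (hYq j h').2 h.2,
        fun h => ⟨Or.inl h, (hXq j h).2⟩⟩
    simp only [Finset.mem_filter, Finset.mem_powersetCard]
    refine ⟨⟨fun j hj => ?_, ?_⟩, by rw [hf, hXc]⟩
    · rcases Finset.mem_union.1 hj with h | h
      · exact (hXq j h).1
      · exact (hYq j h).1
    · rw [Finset.card_union_of_disjoint hdisj]; omega
  · intro D _
    exact Finset.filter_union_filter_not_eq q D
  · rintro ⟨X, Y⟩ h
    simp only [Finset.mem_product, Finset.mem_powersetCard] at h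
    obtain ⟨⟨hX, -⟩, hY, -⟩ := h
    have hXq : ∀ j ∈ X, q j := fun j hj => (Finset.mem_filter.1 (hX hj)).2
    have hYq : ∀ j ∈ Y, ¬q j := fun j hj => (Finset.mem_filter.1 (hY hj)).2
    ext j <;> simp only [Finset.mem_filter, Finset.mem_union]
    · exact ⟨fun h => h.1.resolve_right fun h' => hYq j h' h.2, fun h => ⟨Or.inl h, hXq j h⟩⟩
    · exact ⟨fun h => h.1.resolve_left fun h' => h.2 (hXq j h'), fun h => ⟨Or.inr h, hYq j h⟩⟩

theorem sum_powersetCard_card_filter {ι : Type*} [DecidableEq ι] (T : Finset ι) (q : ι → Prop)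
    [DecidablePred q] (n : ℕ) (g : ℕ → ℝ) :
    ∑ D ∈ T.powersetCard n, g (D.filter q).card
      = ∑ k ∈ Finset.range (n + 1), (((T.filter q).card.choose k *
        (T.filter fun j => ¬q j).card.choose (n - k) : ℕ) : ℝ) * g k := by
  rw [← Finset.sum_fiberwise_of_maps_to (t := Finset.range (n + 1))
    (g := fun D => (D.filter q).card)]
  · refine Finset.sum_congr rfl fun k hk => ?_
    rw [← card_filter_powersetCard T q (Nat.lt_succ_iff.1 (Finset.mem_range.1 hk)),
      ← nsmul_eq_mul, ← Finset.sum_const]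
    exact Finset.sum_congr rfl fun D hD => by rw [(Finset.mem_filter.1 hD).2]
  · intro D hD
    rw [Finset.mem_range, Nat.lt_succ_iff, ← (Finset.mem_powersetCard.1 hD).2]
    exact Finset.card_filter_le _ _

/-! ### Spins and batches -/

section Spins

variable {N : ℕ}

theorem spinVal_eq_one_or (s : SpinConfig N) (i : Fin N) : spinVal s i = 1 ∨ spinVal s i = -1 := by
  unfold spinVal
  rcases Int.units_eq_one_or (s i) with h | h <;> simp [h]

theorem spinVal_eq (s : SpinConfig N) (i : Fin N) :
    spinVal s i = 1 - 2 * if s i = -1 then 1 else 0 := by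
  unfold spinVal
  rcases Int.units_eq_one_or (s i) with h | h
  · simp [h]
  · simp [h]; norm_num

theorem spinVal_sq (s : SpinConfig N) (i : Fin N) : spinVal s i ^ 2 = 1 := by
  rcases spinVal_eq_one_or s i with h | h <;> simp [h]

theorem abs_spinVal (s : SpinConfig N) (i : Fin N) : |spinVal s i| = 1 := by
  rcases spinVal_eq_one_or s i with h | h <;> simp [h]

theorem sum_spinVal (s : SpinConfig N) (D : Finset (Fin N)) :
    ∑ j ∈ D, spinVal s j = (D.card : ℝ) - 2 * (D.filter fun j => s j = -1).card := by
  simp only [spinVal_eq, Finset.sum_sub_distrib, ← Finset.mul_sum, Finset.sum_boole,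
    Finset.sum_const, nsmul_eq_mul, mul_one]

theorem spinVal_flipSpin_self (s : SpinConfig N) (i : Fin N) :
    spinVal (flipSpin s i) i = -spinVal s i := by
  simp [spinVal, flipSpin]

theorem spinVal_flipSpin_of_ne (s : SpinConfig N) {i j : Fin N} (h : j ≠ i) :
    spinVal (flipSpin s i) j = spinVal s j := by
  simp [spinVal, flipSpin, h]

theorem magnetization_flipSpin (s : SpinConfig N) (i : Fin N) :
    magnetization (flipSpin s i) = magnetization s - 2 * spinVal s i / N := by
  unfold magnetization
  rw [← Finset.add_sum_erase _ _ (Finset.mem_univ i),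
    ← Finset.add_sum_erase _ (spinVal s) (Finset.mem_univ i), spinVal_flipSpin_self,
    Finset.sum_congr rfl fun j hj => spinVal_flipSpin_of_ne s (Finset.ne_of_mem_erase hj)]
  ring

theorem magnetization_mem_Icc (s : SpinConfig N) : magnetization s ∈ Icc (-1 : ℝ) 1 := by
  refine abs_le.1 ?_
  unfold magnetization
  rw [abs_div, Nat.abs_cast]
  refine div_le_one_of_le₀ ?_ (Nat.cast_nonneg _)
  refine (Finset.abs_sum_le_sum_abs _ _).trans ?_
  simp [abs_spinVal]

theorem sum_batchesAt (n : ℕ) (i : Fin N) (g : Finset (Fin N) → ℝ) :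
    ∑ C ∈ batchesAt N (n + 1) i, g C
      = ∑ D ∈ (Finset.univ.erase i).powersetCard n, g (insert i D) := by
  refine Finset.sum_bij' (fun C _ => C.erase i) (fun D _ => insert i D) ?_ ?_ ?_ ?_ ?_
  · intro C hC
    obtain ⟨h1, h2⟩ := (Finset.mem_filter.1 hC).2
    rw [Finset.mem_powersetCard, Finset.card_erase_of_mem h1]
    exact ⟨Finset.erase_subset_erase _ (Finset.subset_univ _), by omega⟩
  · intro D hD
    rw [Finset.mem_powersetCard] at hD
    have : i ∉ D := fun h => Finset.notMem_erase i _ (hD.1 h)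
    simp [batchesAt, Finset.card_insert_of_notMem this, hD.2]
  · intro C hC
    exact Finset.insert_erase (Finset.mem_filter.1 hC).2.1
  · intro D hD
    rw [Finset.mem_powersetCard] at hD
    exact Finset.erase_insert fun h => Finset.notMem_erase i _ (hD.1 h)
  · intro C hC
    rw [Finset.insert_erase (Finset.mem_filter.1 hC).2.1]

theorem card_batchesAt (n : ℕ) (i : Fin N) :
    (batchesAt N (n + 1) i).card = (N - 1).choose n := by
  have := sum_batchesAt n i fun _ => 1
  simp only [Finset.sum_const, nsmul_eq_mul, mul_one, Finset.card_powersetCard,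
    Finset.card_erase_of_mem (Finset.mem_univ i), Finset.card_univ, Fintype.card_fin] at this
  exact_mod_cast this

theorem batchEnergy_eq (p : ℕ) (s : SpinConfig N) (C : Finset (Fin N)) :
    batchEnergy p s C = -(1 / (2 * (p : ℝ))) * (∑ j ∈ C, spinVal s j) ^ 2 := by
  rw [batchEnergy, sq, Finset.sum_mul_sum]

/-- If `S` is the sum of the other spins and `x` the selected one, reversing `x` raises the energy
by `((S+x)² - (S-x)²)/(2p) = 2xS/p`. -/
theorem acceptProb_insert (n : ℕ) (β : ℝ) (s : SpinConfig N) (i : Fin N) {D : Finset (Fin N)}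
    (hi : i ∉ D) (hD : D.card = n) :
    acceptProb (n + 1) β s i (insert i D) = Real.exp (-(2 * β / (n + 1)) *
      max (spinVal s i * ((n : ℝ) - 2 * (D.filter fun j => s j = -1).card)) 0) := by
  have hfl : ∑ j ∈ D, spinVal (flipSpin s i) j = ∑ j ∈ D, spinVal s j :=
    Finset.sum_congr rfl fun j hj => spinVal_flipSpin_of_ne s fun h => hi (h ▸ hj)
  rw [acceptProb, batchEnergy_eq, batchEnergy_eq, Finset.sum_insert hi, Finset.sum_insert hi, hfl,
    spinVal_flipSpin_self, sum_spinVal, hD]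
  congr 1
  set S := (n : ℝ) - 2 * (D.filter fun j => s j = -1).card
  set x := spinVal s i
  have e : -(1 / (2 * ((n + 1 : ℕ) : ℝ))) * (-x + S) ^ 2
      - -(1 / (2 * ((n + 1 : ℕ) : ℝ))) * (x + S) ^ 2 = 2 / ((n : ℝ) + 1) * (x * S) := by
    push_cast
    field_simp
    ring
  have e0 : (0 : ℝ) = 2 / ((n : ℝ) + 1) * 0 := by ring
  rw [e]
  nth_rewrite 1 [e0]
  rw [← mul_max_of_nonneg _ _ (by positivity : (0 : ℝ) ≤ 2 / ((n : ℝ) + 1))]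
  ring

/-- The probability that a reversal at the site `i` is accepted. -/
def meanAccept (p : ℕ) (β : ℝ) (s : SpinConfig N) (i : Fin N) : ℝ :=
  ∑ C ∈ batchesAt N p i, 1 / ((batchesAt N p i).card : ℝ) * acceptProb p β s i C

theorem meanAccept_eq (n : ℕ) (β : ℝ) (s : SpinConfig N) (i : Fin N) :
    meanAccept (n + 1) β s i = ∑ k ∈ Finset.range (n + 1),
      ((((Finset.univ.erase i).filter fun j => s j = -1).card.choose k *
        ((Finset.univ.erase i).filter fun j => ¬s j = -1).card.choose (n - k) : ℕ) : ℝ)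
        / ((N - 1).choose n : ℕ) *
        Real.exp (-(2 * β / (n + 1)) * max (spinVal s i * ((n : ℝ) - 2 * k)) 0) := by
  unfold meanAccept
  rw [← Finset.mul_sum, sum_batchesAt, card_batchesAt]
  have : ∀ D ∈ (Finset.univ.erase i).powersetCard n, acceptProb (n + 1) β s i (insert i D)
      = (fun k : ℕ => Real.exp (-(2 * β / (n + 1)) *
        max (spinVal s i * ((n : ℝ) - 2 * k)) 0)) (D.filter fun j => s j = -1).card := by
    intro D hD
    rw [Finset.mem_powersetCard] at hD
    exact acceptProb_insert n β s i (fun h => Finset.notMem_erase i _ (hD.1 h)) hD.2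
  rw [Finset.sum_congr rfl this, sum_powersetCard_card_filter _ (fun j => s j = -1) n
    fun k => Real.exp (-(2 * β / (n + 1)) * max (spinVal s i * ((n : ℝ) - 2 * k)) 0),
    Finset.mul_sum]
  exact Finset.sum_congr rfl fun k _ => by ring

/-- The acceptance rate is `S₂` for a plus spin and `S₁` for a minus spin. Written as one affine
function of `x`, it sums over the sites to the drift exactly, because `x² = 1`. -/
theorem rbS1_add_rbS2_eq (n : ℕ) (β m x : ℝ) (hx : x = 1 ∨ x = -1) :
    (rbS1 (n + 1) β m + rbS2 (n + 1) β m) / 2 - x * (rbS1 (n + 1) β m - rbS2 (n + 1) β m) / 2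
      = ∑ k ∈ Finset.range (n + 1), (n.choose k : ℝ) *
        (((1 - m) / 2) ^ k * ((1 + m) / 2) ^ (n - k)) *
          Real.exp (-(2 * β / (n + 1)) * max (x * ((n : ℝ) - 2 * k)) 0) := by
  rcases hx with rfl | rfl
  · simp only [one_mul]
    rw [← rbS2_succ]
    ring
  · simp only [neg_one_mul]
    rw [← rbS1_succ]
    ring

theorem abs_meanAccept_sub_le (n : ℕ) {β : ℝ} (hβ : 0 ≤ β) (hN : n + 1 ≤ N) (s : SpinConfig N)
    (i : Fin N) :
    |meanAccept (n + 1) β s i -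
      ((rbS1 (n + 1) β (magnetization s) + rbS2 (n + 1) β (magnetization s)) / 2
        - spinVal s i * (rbS1 (n + 1) β (magnetization s) - rbS2 (n + 1) β (magnetization s)) / 2)|
      ≤ (n + 1) * (3 * 2 ^ n * (n * (n + 1))) / N := by
  have hN' : (0 : ℝ) < N := by exact_mod_cast (by omega : 0 < N)
  have hm := magnetization_mem_Icc s
  rw [rbS1_add_rbS2_eq n β _ _ (spinVal_eq_one_or s i), meanAccept_eq, ← Finset.sum_sub_distrib]
  have hcard := Finset.card_filter_add_card_filter_not (s := Finset.univ.erase i)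
    (fun j => s j = -1)
  rw [Finset.card_erase_of_mem (Finset.mem_univ i), Finset.card_univ, Fintype.card_fin] at hcard
  have hsum := sum_spinVal s (Finset.univ.erase i)
  have herase := Finset.add_sum_erase Finset.univ (spinVal s) (Finset.mem_univ i)
  have htot : ∑ j, spinVal s j = N * magnetization s := by
    unfold magnetization
    field_simp
  rw [Finset.card_erase_of_mem (Finset.mem_univ i), Finset.card_univ, Fintype.card_fin,
    Nat.cast_sub (by omega)] at hsum
  set a := ((Finset.univ.erase i).filter fun j => s j = -1).card
  set b := ((Finset.univ.erase i).filter fun j => ¬s j = -1).card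
  have hab : a + b + 1 = N := by omega
  have habr : (a : ℝ) + b + 1 = N := by exact_mod_cast hab
  push_cast at hsum
  have ha : (a : ℝ) / N - (1 - magnetization s) / 2 = (spinVal s i - 1) / 2 / N := by
    field_simp
    linarith
  have hb : (b : ℝ) / N - (1 + magnetization s) / 2 = (-1 - spinVal s i) / 2 / N := by
    field_simp
    linarith
  have hau : |(a : ℝ) / N - (1 - magnetization s) / 2| ≤ 1 / N := by
    rw [ha, abs_div, Nat.abs_cast]
    gcongr
    rcases spinVal_eq_one_or s i with h | h <;> rw [h] <;> norm_num
  have hbv : |(b : ℝ) / N - (1 + magnetization s) / 2| ≤ 1 / N := by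
    rw [hb, abs_div, Nat.abs_cast]
    gcongr
    rcases spinVal_eq_one_or s i with h | h <;> rw [h] <;> norm_num
  have hN1 : N - 1 = a + b := by omega
  rw [hN1]
  refine (Finset.abs_sum_le_sum_abs _ _).trans ((Finset.sum_le_sum (g := fun _ =>
    3 * 2 ^ n * ((n : ℝ) * (n + 1)) / N) fun k hk => ?_).trans ?_)
  · rw [← sub_mul, abs_mul, Real.abs_exp]
    have h := abs_hypergeometric_sub_le (Nat.lt_succ_iff.1 (Finset.mem_range.1 hk)) hN hab
      (u := (1 - magnetization s) / 2) (v := (1 + magnetization s) / 2)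
      ⟨by linarith [hm.2], by linarith [hm.1]⟩ ⟨by linarith [hm.1], by linarith [hm.2]⟩ hau hbv
    refine le_trans (mul_le_of_le_one_right (abs_nonneg _) ?_) h
    rw [Real.exp_le_one_iff, neg_mul]
    exact neg_nonpos.2 (mul_nonneg (by positivity) (le_max_right _ _))
  · rw [Finset.sum_const, Finset.card_range, nsmul_eq_mul]
    push_cast
    exact le_of_eq (by ring)

/-! ### One step of the chain -/

theorem sum_rbTransition_mul (p : ℕ) (β : ℝ) (s : SpinConfig N) (h : SpinConfig N → ℝ) :
    ∑ s', rbTransition p β s s' * h s' = ∑ i : Fin N, 1 / (N : ℝ) *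
      ∑ C ∈ batchesAt N p i, 1 / ((batchesAt N p i).card : ℝ) *
        (acceptProb p β s i C * h (flipSpin s i) + (1 - acceptProb p β s i C) * h s) := by
  unfold rbTransition
  simp only [Finset.sum_mul]
  rw [Finset.sum_comm]
  refine Finset.sum_congr rfl fun i _ => ?_
  simp only [mul_assoc, Finset.sum_mul]
  rw [← Finset.mul_sum, Finset.sum_comm]
  congr 1
  refine Finset.sum_congr rfl fun C _ => ?_
  rw [← Finset.mul_sum]
  congr 1
  simp only [add_mul, Finset.sum_add_distrib, mul_assoc, ← Finset.mul_sum, ite_mul, one_mul,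
    zero_mul, Finset.sum_ite_eq', Finset.mem_univ, if_true]

theorem card_batchesAt_pos {p : ℕ} (hp : 1 ≤ p) (hN : p ≤ N) (i : Fin N) :
    0 < (batchesAt N p i).card := by
  obtain ⟨n, rfl⟩ : ∃ n, p = n + 1 := ⟨p - 1, by omega⟩
  rw [card_batchesAt]
  exact Nat.choose_pos (by omega)

theorem sum_rbTransition {p : ℕ} (hp : 1 ≤ p) (hN : p ≤ N) (β : ℝ) (s : SpinConfig N) :
    ∑ s', rbTransition p β s s' = 1 := by
  have hN' : (N : ℝ) ≠ 0 := by exact_mod_cast (by omega : N ≠ 0)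
  have h := sum_rbTransition_mul p β s fun _ => 1
  simp only [mul_one, add_sub_cancel] at h
  rw [h]
  have : ∀ i : Fin N, ∑ C ∈ batchesAt N p i, 1 / ((batchesAt N p i).card : ℝ) = 1 := fun i => by
    have := card_batchesAt_pos hp hN i
    rw [Finset.sum_const, nsmul_eq_mul, mul_one_div_cancel (by positivity)]
  simp only [this, mul_one, Finset.sum_const, Finset.card_univ, Fintype.card_fin, nsmul_eq_mul]
  exact mul_one_div_cancel hN'

theorem acceptProb_mem_Icc (p : ℕ) {β : ℝ} (hβ : 0 ≤ β) (s : SpinConfig N) (i : Fin N)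
    (C : Finset (Fin N)) : acceptProb p β s i C ∈ Icc (0 : ℝ) 1 := by
  refine ⟨(Real.exp_pos _).le, ?_⟩
  rw [acceptProb, Real.exp_le_one_iff, neg_mul]
  exact neg_nonpos.2 (mul_nonneg hβ (le_max_right _ _))

theorem rbTransition_nonneg (p : ℕ) {β : ℝ} (hβ : 0 ≤ β) (s s' : SpinConfig N) :
    0 ≤ rbTransition p β s s' := by
  refine Finset.sum_nonneg fun i _ => mul_nonneg (by positivity) <| Finset.sum_nonneg fun C _ =>
    mul_nonneg (by positivity) ?_
  have := acceptProb_mem_Icc p hβ s i C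
  have h1 : (0 : ℝ) ≤ if s' = flipSpin s i then 1 else 0 := by split_ifs <;> norm_num
  have h2 : (0 : ℝ) ≤ if s' = s then 1 else 0 := by split_ifs <;> norm_num
  exact add_nonneg (mul_nonneg this.1 h1) (mul_nonneg (by linarith [this.2]) h2)

theorem abs_magnetization_sub_le_of_rbTransition_ne_zero {p : ℕ} {β : ℝ} {s s' : SpinConfig N}
    (h : rbTransition p β s s' ≠ 0) : |magnetization s' - magnetization s| ≤ 2 / N := by
  by_cases h1 : s' = s
  · rw [h1, sub_self, abs_zero]; positivity
  by_cases h2 : ∃ i, s' = flipSpin s i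
  · obtain ⟨i, rfl⟩ := h2
    rw [magnetization_flipSpin, sub_sub_cancel_left, abs_neg, abs_div, abs_mul, abs_spinVal,
      Nat.abs_cast]
    norm_num
  · refine absurd (Finset.sum_eq_zero fun i _ => ?_) h
    rw [Finset.sum_eq_zero, mul_zero]
    intro C _
    rw [if_neg h1, if_neg fun h => h2 ⟨i, h⟩]
    ring

theorem sum_rbTransition_mul_magnetization_sub (p : ℕ) (β : ℝ)
    (s : SpinConfig N) :
    ∑ s', rbTransition p β s s' * (magnetization s' - magnetization s)
      = 1 / N * ∑ i, 1 / (N : ℝ) * (-2 * spinVal s i * meanAccept p β s i) := by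
  rw [sum_rbTransition_mul, Finset.mul_sum]
  refine Finset.sum_congr rfl fun i _ => ?_
  rw [meanAccept, Finset.mul_sum, Finset.mul_sum, Finset.mul_sum, Finset.mul_sum]
  refine Finset.sum_congr rfl fun C _ => ?_
  rw [magnetization_flipSpin]
  ring

theorem sum_weighted_spin_eq_rbDrift (hN : 0 < N) (p : ℕ) (β : ℝ) (s : SpinConfig N) :
    ∑ i, 1 / (N : ℝ) * (-2 * spinVal s i *
      ((rbS1 p β (magnetization s) + rbS2 p β (magnetization s)) / 2
        - spinVal s i * (rbS1 p β (magnetization s) - rbS2 p β (magnetization s)) / 2))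
      = rbDrift p β (magnetization s) := by
  have hN' : (N : ℝ) ≠ 0 := by exact_mod_cast hN.ne'
  set A := rbS1 p β (magnetization s)
  set B := rbS2 p β (magnetization s)
  have e : ∀ i, 1 / (N : ℝ) * (-2 * spinVal s i * ((A + B) / 2 - spinVal s i * (A - B) / 2))
      = 1 / (N : ℝ) * (A - B) - (A + B) / N * spinVal s i := fun i => by
    linear_combination 1 / (N : ℝ) * (A - B) * spinVal_sq s i
  rw [Finset.sum_congr rfl fun i _ => e i, Finset.sum_sub_distrib,
    ← Finset.mul_sum _ _ ((A + B) / (N : ℝ)), Finset.sum_const, Finset.card_univ, Fintype.card_fin,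
    nsmul_eq_mul]
  change _ = (A - B) - magnetization s * (A + B)
  unfold magnetization
  field_simp

theorem exists_abs_mean_step_sub_le {p : ℕ} (hp : 1 ≤ p) {β : ℝ} (hβ : 0 ≤ β) :
    ∃ c : ℝ, 0 ≤ c ∧ ∀ (N : ℕ), p ≤ N → ∀ s : SpinConfig N,
      |∑ s', rbTransition p β s s' * (magnetization s' - magnetization s)
        - rbDrift p β (magnetization s) / N| ≤ c / (N : ℝ) ^ 2 := by
  obtain ⟨n, rfl⟩ : ∃ n, p = n + 1 := ⟨p - 1, by omega⟩
  refine ⟨2 * ((n + 1) * (3 * 2 ^ n * (n * (n + 1)))), by positivity, fun N hN s => ?_⟩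
  have hN0 : 0 < N := by omega
  have hN' : (0 : ℝ) < N := by exact_mod_cast hN0
  rw [sum_rbTransition_mul_magnetization_sub, ← sum_weighted_spin_eq_rbDrift hN0,
    show ∀ x y : ℝ, 1 / (N : ℝ) * x - y / N = 1 / N * (x - y) from fun x y => by ring,
    ← Finset.sum_sub_distrib, abs_mul,
    abs_of_pos (by positivity : 0 < 1 / (N : ℝ))]
  have : ∀ i ∈ (Finset.univ : Finset (Fin N)), |1 / (N : ℝ) * (-2 * spinVal s i
      * meanAccept (n + 1) β s i)
      - 1 / (N : ℝ) * (-2 * spinVal s i *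
      ((rbS1 (n + 1) β (magnetization s) + rbS2 (n + 1) β (magnetization s)) / 2
        - spinVal s i * (rbS1 (n + 1) β (magnetization s)
          - rbS2 (n + 1) β (magnetization s)) / 2))|
      ≤ 1 / N * (2 * ((n + 1) * (3 * 2 ^ n * (n * (n + 1))) / N)) := fun i _ => by
    rw [← mul_sub, ← mul_sub, abs_mul, abs_of_pos (by positivity : 0 < 1 / (N : ℝ)), abs_mul,
      abs_mul, abs_spinVal]
    have := abs_meanAccept_sub_le n hβ hN s i
    norm_num
    gcongr
  refine (mul_le_mul_of_nonneg_left ((Finset.abs_sum_le_sum_abs _ _).trans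
    (Finset.sum_le_sum this)) (by positivity)).trans (le_of_eq ?_)
  rw [Finset.sum_const, Finset.card_univ, Fintype.card_fin, nsmul_eq_mul]
  field_simp

end Spins

/-! ### Laws of the chain at finitely many times. -/

instance measurableSingletonClass_intUnits : MeasurableSingletonClass ℤˣ where
  measurableSet_singleton u :=
    ⟨{(u : ℤ)}, measurableSet_singleton _, by ext v; simp [Units.ext_iff]⟩

section Chain

variable {N p : ℕ} {β : ℝ} {Ω : Type*} [MeasurableSpace Ω] {P : Measure Ω}
  {σ : ℕ → Ω → SpinConfig N}

theorem measureReal_finite_cover [IsProbabilityMeasure P] {ι : Type*} [Finite ι] [MeasurableSpace ι]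
    [MeasurableSingletonClass ι] {X : Ω → ι} (hX : Measurable X) (Q : Finset ι) (E : Set Ω)
    (hE : MeasurableSet E) :
    P.real {ω | X ω ∈ Q ∧ ω ∈ E} = ∑ q ∈ Q, P.real {ω | X ω = q ∧ ω ∈ E} := by
  have : {ω | X ω ∈ Q ∧ ω ∈ E} = ⋃ q ∈ Q, {ω | X ω = q ∧ ω ∈ E} := by
    ext ω; simp
  rw [this, measureReal_biUnion_finset]
  · intro q _ q' _ hqq'
    exact Set.disjoint_left.2 fun ω h h' => hqq' (h.1.symm.trans h'.1)
  · exact fun q _ => (hX (measurableSet_singleton q)).inter hE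

/-- The path of the chain up to time `n`. -/
def chainPath (σ : ℕ → Ω → SpinConfig N) (n : ℕ) (ω : Ω) : Fin (n + 1) → SpinConfig N :=
  fun k => σ k ω

theorem measurable_chainPath (hσ : ∀ n, Measurable (σ n)) (n : ℕ) : Measurable (chainPath σ n) :=
  measurable_pi_lambda _ fun k => hσ k

theorem IsRandomBatchChain.measureReal_path_eq (h : IsRandomBatchChain p β P σ) (n : ℕ)
    (q : Fin (n + 1) → SpinConfig N) (s' : SpinConfig N) :
    P.real {ω | chainPath σ n ω = q ∧ ω ∈ {ω | σ (n + 1) ω = s'}}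
      = P.real {ω | chainPath σ n ω = q} * rbTransition p β (q (Fin.last n)) s' := by
  have := h n fun k => if hk : k < n + 1 then q ⟨k, hk⟩ else s'
  have e1 : {ω | ∀ k ≤ n + 1, σ k ω = if hk : k < n + 1 then q ⟨k, hk⟩ else s'}
      = {ω | chainPath σ n ω = q ∧ ω ∈ {ω | σ (n + 1) ω = s'}} := by
    ext ω
    simp only [mem_ofPred_eq, chainPath, funext_iff]
    constructor
    · intro H
      refine ⟨fun k => ?_, ?_⟩
      · have := H k (by omega)
        rwa [dif_pos k.2] at this
      · have := H (n + 1) le_rfl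
        rwa [dif_neg (lt_irrefl _)] at this
    · rintro ⟨H1, H2⟩ k hk
      split_ifs with hk'
      · exact H1 ⟨k, hk'⟩
      · obtain rfl : k = n + 1 := by omega
        exact H2
  have e2 : {ω | ∀ k ≤ n, σ k ω = if hk : k < n + 1 then q ⟨k, hk⟩ else s'}
      = {ω | chainPath σ n ω = q} := by
    ext ω
    simp only [mem_ofPred_eq, chainPath, funext_iff]
    constructor
    · intro H k
      have := H k (by omega)
      rwa [dif_pos k.2] at this
    · intro H k hk
      rw [dif_pos (by omega)]
      exact H ⟨k, by omega⟩
  rw [e1, e2, dif_pos (Nat.lt_succ_self n), dif_neg (lt_irrefl _)] at this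
  exact this

/-- The path-wise Markov property is summed over the intermediate states. Time `0` is kept because
the comparison solution starts from the random initial magnetization. -/
theorem IsRandomBatchChain.measureReal_two_times [IsProbabilityMeasure P]
    (h : IsRandomBatchChain p β P σ)
    (hσ : ∀ n, Measurable (σ n)) (n : ℕ) (a s s' : SpinConfig N) :
    P.real {ω | (σ 0 ω = a ∧ σ n ω = s) ∧ σ (n + 1) ω = s'}
      = P.real {ω | σ 0 ω = a ∧ σ n ω = s} * rbTransition p β s s' := by
  classical
  have hX := measurable_chainPath hσ n
  set Q : Finset (Fin (n + 1) → SpinConfig N) :=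
    Finset.univ.filter fun q => q 0 = a ∧ q (Fin.last n) = s
  have hQ : ∀ ω, chainPath σ n ω ∈ Q ↔ σ 0 ω = a ∧ σ n ω = s := fun ω => by
    simp [Q, chainPath]
  have h1 := measureReal_finite_cover (P := P) hX Q {ω | σ (n + 1) ω = s'}
    (hσ (n + 1) (measurableSet_singleton s'))
  have h2 := measureReal_finite_cover (P := P) hX Q univ MeasurableSet.univ
  simp only [hQ, mem_univ, and_true] at h1 h2
  rw [h2, Finset.sum_mul]
  refine h1.trans (Finset.sum_congr rfl fun q hq => ?_)
  rw [h.measureReal_path_eq, (Finset.mem_filter.1 hq).2.2]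

theorem IsRandomBatchChain.ae_abs_magnetization_sub_le [IsProbabilityMeasure P]
    (h : IsRandomBatchChain p β P σ)
    (hσ : ∀ n, Measurable (σ n)) :
    ∀ᵐ ω ∂P, ∀ n, |magnetization (σ (n + 1) ω) - magnetization (σ n ω)| ≤ 2 / N := by
  rw [ae_all_iff]
  intro n
  have hz : ∀ a s s' : SpinConfig N, rbTransition p β s s' = 0 →
      ∀ᵐ ω ∂P, ¬((σ 0 ω = a ∧ σ n ω = s) ∧ σ (n + 1) ω = s') := fun a s s' h0 => by
    have := h.measureReal_two_times hσ n a s s'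
    rw [h0, mul_zero, measureReal_eq_zero_iff] at this
    rw [ae_iff]
    simpa only [not_not] using this
  have hall : ∀ᵐ ω ∂P, ∀ a s s' : SpinConfig N, rbTransition p β s s' = 0 →
      ¬((σ 0 ω = a ∧ σ n ω = s) ∧ σ (n + 1) ω = s') := by
    simp only [ae_all_iff]
    exact hz
  filter_upwards [hall] with ω hω
  refine abs_magnetization_sub_le_of_rbTransition_ne_zero (p := p) (β := β) fun h0 => ?_
  exact hω (σ 0 ω) (σ n ω) (σ (n + 1) ω) h0 ⟨⟨rfl, rfl⟩, rfl⟩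

/-- The mean of a function of the states at the times `0` and `n`. -/
def pairMean (P : Measure Ω) (σ : ℕ → Ω → SpinConfig N) (n : ℕ)
    (g : SpinConfig N → SpinConfig N → ℝ) : ℝ :=
  ∑ a, ∑ s, P.real {ω | σ 0 ω = a ∧ σ n ω = s} * g a s

theorem pairMean_mono (n : ℕ) {g g' : SpinConfig N → SpinConfig N → ℝ}
    (hg : ∀ a s, g a s ≤ g' a s) : pairMean P σ n g ≤ pairMean P σ n g' :=
  Finset.sum_le_sum fun a _ => Finset.sum_le_sum fun s _ =>
    mul_le_mul_of_nonneg_left (hg a s) measureReal_nonneg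

theorem pairMean_affine [IsProbabilityMeasure P] (hσ : ∀ n, Measurable (σ n)) (n : ℕ)
    (g : SpinConfig N → SpinConfig N → ℝ) (c d : ℝ) :
    pairMean P σ n (fun a s => c * g a s + d) = c * pairMean P σ n g + d := by
  have hone : ∑ a, ∑ s, P.real {ω | σ 0 ω = a ∧ σ n ω = s} = 1 := by
    have hX : Measurable fun ω => (σ 0 ω, σ n ω) := (hσ 0).prodMk (hσ n)
    have := measureReal_finite_cover (P := P) hX Finset.univ univ MeasurableSet.univ
    simp only [Finset.mem_univ, mem_univ, and_true, ofPred_true, probReal_univ] at this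
    rw [← Finset.univ_product_univ, Finset.sum_product] at this
    simpa only [Prod.mk.injEq] using this.symm
  unfold pairMean
  simp only [mul_add, Finset.sum_add_distrib, ← Finset.sum_mul]
  rw [hone, one_mul, Finset.mul_sum]
  congr 1
  refine Finset.sum_congr rfl fun a _ => ?_
  rw [Finset.mul_sum]
  exact Finset.sum_congr rfl fun s _ => by ring

theorem IsRandomBatchChain.pairMean_succ [IsProbabilityMeasure P] (h : IsRandomBatchChain p β P σ)
    (hσ : ∀ n, Measurable (σ n)) (n : ℕ) (g : SpinConfig N → SpinConfig N → ℝ) :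
    pairMean P σ (n + 1) g
      = pairMean P σ n fun a s => ∑ s', rbTransition p β s s' * g a s' := by
  unfold pairMean
  refine Finset.sum_congr rfl fun a _ => ?_
  have key : ∀ s', P.real {ω | σ 0 ω = a ∧ σ (n + 1) ω = s'}
      = ∑ s, P.real {ω | σ 0 ω = a ∧ σ n ω = s} * rbTransition p β s s' := fun s' => by
    have := measureReal_finite_cover (P := P) (hσ n) Finset.univ {ω | σ 0 ω = a ∧ σ (n + 1) ω = s'}
      ((hσ 0 (measurableSet_singleton a)).inter (hσ (n + 1) (measurableSet_singleton s')))
    simp only [Finset.mem_univ, true_and] at this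
    refine this.trans (Finset.sum_congr rfl fun s _ => ?_)
    rw [← h.measureReal_two_times hσ]
    congr 1
    ext ω
    simp only [mem_ofPred_eq]
    tauto
  simp only [key, Finset.sum_mul, Finset.mul_sum]
  rw [Finset.sum_comm]
  exact Finset.sum_congr rfl fun s _ => Finset.sum_congr rfl fun s' _ => by ring

theorem measureReal_le_pairMean [IsProbabilityMeasure P] (hσ : ∀ n, Measurable (σ n)) (n : ℕ)
    (g : SpinConfig N → SpinConfig N → ℝ) {ε : ℝ} (hε : 0 < ε) :
    P.real {ω | ε ≤ |g (σ 0 ω) (σ n ω)|}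
      ≤ pairMean P σ n (fun a s => g a s ^ 2) / ε ^ 2 := by
  classical
  have hX : Measurable fun ω => (σ 0 ω, σ n ω) := (hσ 0).prodMk (hσ n)
  have := measureReal_finite_cover (P := P) hX
    (Finset.univ.filter fun q => ε ≤ |g q.1 q.2|) univ MeasurableSet.univ
  simp only [Finset.mem_filter, Finset.mem_univ, true_and, mem_univ, and_true,
    Prod.ext_iff] at this
  rw [this, Finset.sum_filter, ← Finset.univ_product_univ, Finset.sum_product, pairMean,
    Finset.sum_div]
  refine Finset.sum_le_sum fun a _ => ?_
  rw [Finset.sum_div]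
  refine Finset.sum_le_sum fun s _ => ?_
  rw [mul_div_assoc]
  split_ifs with hs
  · refine le_mul_of_one_le_right measureReal_nonneg ?_
    rw [one_le_div (by positivity), ← sq_abs (g a s)]
    exact pow_le_pow_left₀ hε.le hs 2
  · exact mul_nonneg measureReal_nonneg (by positivity)

end Chain

/-! ### Distance to the solution of the differential equation -/

/-- Expand the square. The cross term involves only the difference of mean increments, which is the
Lipschitz bound `K |D| / N` plus `O(1/N²)`; the quadratic term is `O(1/N²)` because all increments
are `O(1/N)`. -/
theorem one_step_second_moment_le {N p : ℕ} {β : ℝ} (hp : 1 ≤ p) (hN : p ≤ N) (hβ : 0 ≤ β)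
    {K L : ℝ≥0} (hF : InwardField (rbDrift p β) K L) {c : ℝ}
    (hc : ∀ s : SpinConfig N, |∑ s', rbTransition p β s s' * (magnetization s' - magnetization s)
        - rbDrift p β (magnetization s) / N| ≤ c / (N : ℝ) ^ 2)
    (s : SpinConfig N) {y y' : ℝ} (hy : y ∈ Icc (-1 : ℝ) 1)
    (hstep : |y' - y| ≤ L / N)
    (htay : |y' - y - rbDrift p β y / N| ≤ K * L / (N : ℝ) ^ 2) :
    ∑ s', rbTransition p β s s' * (magnetization s' - y') ^ 2
      ≤ (1 + 2 * K / N) * (magnetization s - y) ^ 2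
        + (4 * (c + K * L) + 8 + 2 * L ^ 2) / (N : ℝ) ^ 2 := by
  have hN' : (0 : ℝ) < N := by exact_mod_cast (by omega : 0 < N)
  set D := magnetization s - y
  set ψ := y' - y
  set f := rbDrift p β (magnetization s)
  set f' := rbDrift p β y
  set d := ∑ s', rbTransition p β s s' * (magnetization s' - magnetization s)
  have hm := magnetization_mem_Icc s
  have h1 : ∑ s', rbTransition p β s s' * (magnetization s' - y') ^ 2
      = D ^ 2 + 2 * D * (d - ψ)
        + ∑ s', rbTransition p β s s' * (magnetization s' - magnetization s - ψ) ^ 2 := by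
    have hone := sum_rbTransition hp hN β s
    have : ∀ s', rbTransition p β s s' * (magnetization s' - y') ^ 2
        = (D ^ 2 - 2 * D * ψ) * rbTransition p β s s'
          + 2 * D * (rbTransition p β s s' * (magnetization s' - magnetization s))
          + rbTransition p β s s' * (magnetization s' - magnetization s - ψ) ^ 2 := fun s' => by
      simp only [D, ψ]; ring
    rw [Finset.sum_congr rfl fun s' _ => this s', Finset.sum_add_distrib, Finset.sum_add_distrib,
      ← Finset.mul_sum, ← Finset.mul_sum, hone]
    ring
  have h2 : ∑ s', rbTransition p β s s' * (magnetization s' - magnetization s - ψ) ^ 2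
      ≤ (8 + 2 * L ^ 2) / (N : ℝ) ^ 2 := by
    have hb : ∀ s', rbTransition p β s s' * (magnetization s' - magnetization s - ψ) ^ 2
        ≤ rbTransition p β s s' * ((8 + 2 * L ^ 2) / (N : ℝ) ^ 2) := fun s' => by
      by_cases h0 : rbTransition p β s s' = 0
      · rw [h0, zero_mul, zero_mul]
      refine mul_le_mul_of_nonneg_left ?_ (rbTransition_nonneg p hβ s s')
      have a1 := abs_magnetization_sub_le_of_rbTransition_ne_zero h0
      have a2 : (magnetization s' - magnetization s) ^ 2 ≤ (2 / N) ^ 2 := sq_le_sq' (by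
        linarith [(abs_le.1 a1).1]) (abs_le.1 a1).2
      have a3 : ψ ^ 2 ≤ (L / N) ^ 2 := sq_le_sq' (by
        linarith [(abs_le.1 hstep).1]) (abs_le.1 hstep).2
      have a4 : (8 + 2 * (L : ℝ) ^ 2) / (N : ℝ) ^ 2 = 2 * (2 / N) ^ 2 + 2 * (L / N) ^ 2 := by
        ring
      rw [a4]
      -- This is `(a - b)² ≤ 2a² + 2b²`.
      nlinarith [sq_nonneg (magnetization s' - magnetization s + ψ)]
    refine (Finset.sum_le_sum fun s' _ => hb s').trans ?_
    rw [← Finset.sum_mul, sum_rbTransition hp hN, one_mul]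
  have hD2 : |D| ≤ 2 := by
    rw [abs_le]
    constructor <;> simp only [D] <;> linarith [hm.1, hm.2, hy.1, hy.2]
  have hlip : |f - f'| ≤ K * |D| := by
    have := hF.lipschitz.dist_le_mul _ hm _ hy
    rwa [Real.dist_eq, Real.dist_eq] at this
  have h3 : |d - ψ| ≤ K * |D| / N + (c + K * L) / (N : ℝ) ^ 2 := by
    have e : d - ψ = (d - f / N) + (f - f') / N - (ψ - f' / N) := by ring
    rw [e]
    have t1 : |(f - f') / N| ≤ K * |D| / N := by
      rw [abs_div, Nat.abs_cast]
      gcongr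
    have t2 := hc s
    have t3 := abs_sub ((d - f / N) + (f - f') / N) (ψ - f' / N)
    have t4 := abs_add_le (d - f / N) ((f - f') / N)
    rw [add_div]
    linarith
  have h4 : 2 * D * (d - ψ) ≤ 2 * K / N * D ^ 2 + 4 * (c + K * L) / (N : ℝ) ^ 2 := by
    have hcK : 0 ≤ (c + K * L) / (N : ℝ) ^ 2 := by
      have := (abs_nonneg _).trans (hc s)
      have h' : (0 : ℝ) ≤ K * L / (N : ℝ) ^ 2 := by positivity
      rw [add_div]
      linarith
    calc 2 * D * (d - ψ) ≤ |2 * D * (d - ψ)| := le_abs_self _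
      _ = 2 * |D| * |d - ψ| := by rw [abs_mul, abs_mul, abs_two]
      _ ≤ 2 * |D| * (K * |D| / N + (c + K * L) / (N : ℝ) ^ 2) := by gcongr
      _ = 2 * K / N * |D| ^ 2 + 2 * |D| * ((c + K * L) / (N : ℝ) ^ 2) := by ring
      _ ≤ 2 * K / N * |D| ^ 2 + 2 * 2 * ((c + K * L) / (N : ℝ) ^ 2) := by gcongr
      _ = _ := by rw [sq_abs]; ring
  rw [h1]
  have e : (4 * (c + K * L) + 8 + 2 * (L : ℝ) ^ 2) / (N : ℝ) ^ 2
      = 4 * (c + K * L) / (N : ℝ) ^ 2 + (8 + 2 * L ^ 2) / (N : ℝ) ^ 2 := by ring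
  rw [e]
  linarith

theorem exists_second_moment_le {p : ℕ} (hp : 1 ≤ p) {β : ℝ} (hβ : 0 ≤ β) {φ : ℝ → ℝ≥0 → ℝ}
    (hφ : ∀ x ∈ Icc (-1 : ℝ) 1, φ x 0 = x ∧ SolvesODE (rbDrift p β) (φ x)) (T : ℝ) :
    ∃ A : ℝ, 0 ≤ A ∧ ∀ (N : ℕ), p ≤ N → ∀ {Ω : Type*} [MeasurableSpace Ω] (P : Measure Ω)
      [IsProbabilityMeasure P] (σ : ℕ → Ω → SpinConfig N), (∀ n, Measurable (σ n)) →
      IsRandomBatchChain p β P σ → ∀ n : ℕ, (n : ℝ) ≤ N * T →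
      pairMean P σ n (fun a s => (magnetization s - φ (magnetization a) ((n : ℝ≥0) / N)) ^ 2)
        ≤ A / N := by
  obtain ⟨K, L, hF⟩ := exists_inwardField_rbDrift p hp β
  obtain ⟨c, hc0, hc⟩ := exists_abs_mean_step_sub_le hp hβ
  set C : ℝ := 4 * (c + K * L) + 8 + 2 * L ^ 2 with hC
  have hC0 : 0 ≤ C := by positivity
  refine ⟨max T 0 * C * Real.exp (2 * K * max T 0), by positivity, ?_⟩
  intro N hN Ω _ P _ σ hσ h n hn
  have hN0 : 0 < N := by omega
  have hN' : (0 : ℝ) < N := by exact_mod_cast hN0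
  set u : ℕ → ℝ := fun n => pairMean P σ n
    (fun a s => (magnetization s - φ (magnetization a) ((n : ℝ≥0) / N)) ^ 2) with hu
  have hu0 : u 0 = 0 := by
    refine Finset.sum_eq_zero fun a _ => Finset.sum_eq_zero fun s _ => ?_
    by_cases has : a = s
    · subst has
      simp [(hφ _ (magnetization_mem_Icc a)).1]
    · have : {ω | σ 0 ω = a ∧ σ 0 ω = s} = ∅ := by
        ext ω
        simp only [mem_ofPred_eq, mem_empty_iff_false, iff_false]
        exact fun h => has (h.1.symm.trans h.2)
      simp [this]
  have hrec : ∀ n, u (n + 1) ≤ (1 + 2 * K / N) * u n + C / (N : ℝ) ^ 2 := fun n => by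
    simp only [hu]
    rw [h.pairMean_succ hσ, ← pairMean_affine hσ]
    refine pairMean_mono n fun a s => ?_
    obtain ⟨hx0, hx⟩ := hφ _ (magnetization_mem_Icc a)
    have hx0' : φ (magnetization a) 0 ∈ Icc (-1 : ℝ) 1 := by
      rw [hx0]; exact magnetization_mem_Icc a
    have hle : (n : ℝ≥0) / N ≤ ((n + 1 : ℕ) : ℝ≥0) / N := by gcongr; omega
    have hd : ((((n + 1 : ℕ) : ℝ≥0) / N : ℝ≥0) : ℝ) - ((n : ℝ≥0) / N : ℝ≥0) = 1 / N := by
      push_cast; ring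
    have h1 := hx.abs_sub_le_mul hF hx0' hle
    have h2 := hx.abs_taylor_le hF hx0' hle
    rw [hd] at h1 h2
    exact one_step_second_moment_le hp hN hβ hF (hc N hN) s (hx.mem_Icc hF hx0' _)
      (by rwa [mul_one_div] at h1) (by
        rw [mul_one_div, one_div, inv_pow, ← div_eq_mul_inv] at h2
        exact h2)
  -- At most `N T` steps, each adding `C/N²` and multiplying by `1 + 2K/N`: the sum is `O(1/N)` and
  -- the product stays bounded.
  have hg := discrete_gronwall (u := u) (n₀ := 0) (c := fun _ => 2 * K / N)
    (b := fun _ => C / (N : ℝ) ^ 2) hu0.ge (fun n _ => hrec n) (fun _ _ => by positivity)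
    (fun _ _ => by positivity) (Nat.zero_le n)
  refine hg.trans ?_
  simp only [hu0, zero_add, Finset.sum_const, Nat.card_Ico, Nat.sub_zero, nsmul_eq_mul]
  have hn' : (n : ℝ) ≤ N * max T 0 := hn.trans (by gcongr; exact le_max_left _ _)
  have e1 : (n : ℝ) * (C / (N : ℝ) ^ 2) ≤ max T 0 * C / N := by
    calc (n : ℝ) * (C / (N : ℝ) ^ 2) ≤ N * max T 0 * (C / (N : ℝ) ^ 2) := by gcongr
      _ = _ := by field_simp
  have e2 : (n : ℝ) * (2 * K / N) ≤ 2 * K * max T 0 := by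
    calc (n : ℝ) * (2 * K / N) ≤ N * max T 0 * (2 * K / N) := by gcongr
      _ = _ := by field_simp
  calc (n : ℝ) * (C / (N : ℝ) ^ 2) * Real.exp (n * (2 * K / N))
      ≤ max T 0 * C / N * Real.exp (2 * K * max T 0) := by gcongr
    _ = _ := by ring

/-! ### Uniform convergence on compact time intervals -/

theorem abs_sub_le_mul_of_abs_step_le {a : ℕ → ℝ} {c : ℝ} (h : ∀ n, |a (n + 1) - a n| ≤ c)
    {m n : ℕ} (hmn : m ≤ n) : |a n - a m| ≤ c * (n - m) := by
  induction n, hmn using Nat.le_induction with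
  | base => simp
  | succ n _ ih =>
    have e : a (n + 1) - a m = (a (n + 1) - a n) + (a n - a m) := by ring
    rw [e]
    refine (abs_add_le _ _).trans ?_
    push_cast
    linarith [h n]

/-- A rescaled sequence with small steps is close to a Lipschitz path on `[0, T]` as soon as this
holds on a finite grid. -/
theorem abs_rescaled_sub_lt_of_grid {N : ℕ} (hN : 0 < N) {a : ℕ → ℝ} {x : ℝ≥0 → ℝ} {L h T : ℝ≥0}
    {ε : ℝ} (ha : ∀ n, |a (n + 1) - a n| ≤ 2 / N)
    (hx : ∀ s t : ℝ≥0, s ≤ t → |x t - x s| ≤ L * (t - s)) (hh : 0 < h)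
    (hε : (2 + L) * (h + 1 / N) ≤ 2 * ε / 3)
    (hgrid : ∀ j ∈ Finset.range (⌊T / h⌋₊ + 1),
      |a ⌊(N : ℝ≥0) * (j * h)⌋₊ - x ((⌊(N : ℝ≥0) * (j * h)⌋₊ : ℝ≥0) / N)| < ε / 3) :
    ∀ t ≤ T, |a ⌊(N : ℝ≥0) * t⌋₊ - x t| < ε := by
  intro t ht
  have hN' : (0 : ℝ) < N := by exact_mod_cast hN
  have hN'' : (0 : ℝ≥0) < N := by exact_mod_cast hN
  set j := ⌊t / h⌋₊
  have hj : j ∈ Finset.range (⌊T / h⌋₊ + 1) := by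
    rw [Finset.mem_range, Nat.lt_succ_iff]
    exact Nat.floor_le_floor (by gcongr)
  have hjt : (j : ℝ≥0) * h ≤ t := by
    rw [← le_div_iff₀ hh]
    exact Nat.floor_le zero_le
  have hjt' : (t : ℝ) ≤ j * h + h := by
    have : t / h < j + 1 := Nat.lt_floor_add_one _
    rw [div_lt_iff₀ hh] at this
    have h' : t ≤ j * h + h := by rw [← add_one_mul]; exact this.le
    exact_mod_cast h'
  set n := ⌊(N : ℝ≥0) * t⌋₊
  set n' := ⌊(N : ℝ≥0) * (j * h)⌋₊ with hn'
  have hnn : n' ≤ n := Nat.floor_le_floor (by gcongr)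
  have hn1 : (n : ℝ) ≤ N * t := by
    have : (n : ℝ≥0) ≤ N * t := Nat.floor_le zero_le
    exact_mod_cast this
  have hn2 : (N : ℝ) * (j * h) ≤ n' + 1 := by
    have : (N : ℝ≥0) * (j * h) < n' + 1 := Nat.lt_floor_add_one _
    exact_mod_cast this.le
  have hn3 : (n' : ℝ≥0) / N ≤ t := by
    rw [div_le_iff₀ hN'', mul_comm]
    exact (Nat.floor_le zero_le).trans (by gcongr)
  have h1 := abs_sub_le_mul_of_abs_step_le ha hnn
  have h2 := hx _ _ hn3
  have h3 := hgrid j hj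
  rw [← hn'] at h3
  push_cast at h2
  -- Between a grid time and `t` there are at most `N h + 1` steps, the `1` coming from the integer
  -- part.
  have h4 : 2 / (N : ℝ) * (n - n') ≤ 2 * (h + 1 / N) := by
    rw [div_mul_eq_mul_div, div_le_iff₀ hN']
    have e : 2 * ((h : ℝ) + 1 / N) * N = 2 * (N * h + 1) := by field_simp
    rw [e]
    nlinarith
  have h5 : (L : ℝ) * (t - n' / N) ≤ L * (h + 1 / N) := by
    refine mul_le_mul_of_nonneg_left ?_ L.2
    have : (j : ℝ) * h ≤ n' / N + 1 / N := by
      rw [← add_div, le_div_iff₀ hN']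
      linarith
    linarith
  have e : a n - x t = (a n - a n') + (a n' - x ((n' : ℝ≥0) / N))
      - (x t - x ((n' : ℝ≥0) / N)) := by ring
  rw [e]
  have t1 := abs_sub ((a n - a n') + (a n' - x ((n' : ℝ≥0) / N))) (x t - x ((n' : ℝ≥0) / N))
  have t2 := abs_add_le (a n - a n') (a n' - x ((n' : ℝ≥0) / N))
  linarith

theorem exists_measureReal_not_close_le {p : ℕ} (hp : 1 ≤ p) {β : ℝ} (hβ : 0 ≤ β)
    {φ : ℝ → ℝ≥0 → ℝ}
    (hφ : ∀ x ∈ Icc (-1 : ℝ) 1, φ x 0 = x ∧ SolvesODE (rbDrift p β) (φ x)) (T : ℝ≥0) {ε : ℝ}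
    (hε : 0 < ε) :
    ∃ B : ℝ, ∀ᶠ N : ℕ in atTop, ∀ {Ω : Type*} [MeasurableSpace Ω] (P : Measure Ω)
      [IsProbabilityMeasure P] (σ : ℕ → Ω → SpinConfig N), (∀ n, Measurable (σ n)) →
      IsRandomBatchChain p β P σ →
      P.real {ω | ¬ ∀ t ≤ T, |magnetization (σ ⌊(N : ℝ≥0) * t⌋₊ ω)
        - φ (magnetization (σ 0 ω)) t| < ε} ≤ B / N := by
  obtain ⟨K, L, hF⟩ := exists_inwardField_rbDrift p hp β
  obtain ⟨A, hA0, hA⟩ := exists_second_moment_le hp hβ hφ T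
  -- The mesh makes `(2 + L) h = ε/3`; the rounding error `(2 + L)/N` takes another third for large
  -- `N`, and the grid values the last one. The mesh does not depend on `N`, so neither does the
  -- number of events in the union bound.
  set h : ℝ≥0 := (ε / (3 * (2 + L))).toNNReal with hh
  have hL2 : (0 : ℝ) < 2 + L := by positivity
  have hhpos : 0 < h := Real.toNNReal_pos.2 (by positivity)
  have hhval : (h : ℝ) = ε / (3 * (2 + L)) := Real.coe_toNNReal _ (by positivity)
  refine ⟨(⌊T / h⌋₊ + 1) * (A / (ε / 3) ^ 2), ?_⟩
  have hlarge : ∀ᶠ N : ℕ in atTop, (2 + (L : ℝ)) * (1 / N) < ε / 3 := by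
    have := (tendsto_one_div_atTop_nhds_zero_nat (𝕜 := ℝ)).const_mul (2 + (L : ℝ))
    rw [mul_zero] at this
    exact this.eventually (gt_mem_nhds (by positivity))
  filter_upwards [hlarge, eventually_ge_atTop p] with N hNl hN Ω _ P _ σ hσ hchain
  have hN0 : 0 < N := by omega
  have hN' : (0 : ℝ) < N := by exact_mod_cast hN0
  set t : ℕ → ℕ := fun j => ⌊(N : ℝ≥0) * (j * h)⌋₊ with ht
  set Bad : ℕ → Set Ω := fun j => {ω | ε / 3 ≤ |magnetization (σ (t j) ω)
    - φ (magnetization (σ 0 ω)) ((t j : ℝ≥0) / N)|} with hBad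
  have hsub : {ω | ¬ ∀ t ≤ T, |magnetization (σ ⌊(N : ℝ≥0) * t⌋₊ ω)
      - φ (magnetization (σ 0 ω)) t| < ε} ≤ᵐ[P] ⋃ j ∈ Finset.range (⌊T / h⌋₊ + 1), Bad j := by
    filter_upwards [hchain.ae_abs_magnetization_sub_le hσ] with ω hω hbad
    by_contra hnot
    refine hbad ?_
    obtain ⟨hx0, hx⟩ := hφ _ (magnetization_mem_Icc (σ 0 ω))
    have hx0' : φ (magnetization (σ 0 ω)) 0 ∈ Icc (-1 : ℝ) 1 := by
      rw [hx0]; exact magnetization_mem_Icc _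
    refine abs_rescaled_sub_lt_of_grid hN0 (a := fun n => magnetization (σ n ω)) (L := L) hω
      (fun s t hst => hx.abs_sub_le_mul hF hx0' hst) hhpos ?_ fun j hj => ?_
    · rw [mul_add, hhval]
      have : (2 + (L : ℝ)) * (ε / (3 * (2 + L))) = ε / 3 := by field_simp
      linarith
    · by_contra hj'
      exact hnot (mem_biUnion (Finset.mem_coe.2 hj) (not_lt.1 hj'))
  have hjb : ∀ j ∈ Finset.range (⌊T / h⌋₊ + 1), P.real (Bad j) ≤ A / (ε / 3) ^ 2 / N := by
    intro j hj
    have hjT : (j : ℝ≥0) * h ≤ T := by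
      rw [← le_div_iff₀ hhpos]
      refine le_trans ?_ (Nat.floor_le zero_le)
      exact_mod_cast Nat.lt_succ_iff.1 (Finset.mem_range.1 hj)
    have htj : ((t j : ℕ) : ℝ) ≤ N * T := by
      have : ((t j : ℕ) : ℝ≥0) ≤ N * T := (Nat.floor_le zero_le).trans (by gcongr)
      exact_mod_cast this
    have h1 := measureReal_le_pairMean (P := P) hσ (t j) (fun a s => magnetization s
      - φ (magnetization a) ((t j : ℝ≥0) / N)) (by positivity : 0 < ε / 3)
    have h2 := hA N hN P σ hσ hchain (t j) htj
    refine h1.trans ?_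
    rw [div_right_comm]
    gcongr
  calc P.real _ ≤ P.real (⋃ j ∈ Finset.range (⌊T / h⌋₊ + 1), Bad j) :=
        ENNReal.toReal_mono (measure_ne_top _ _) (measure_mono_ae hsub)
    _ ≤ ∑ j ∈ Finset.range (⌊T / h⌋₊ + 1), P.real (Bad j) := measureReal_biUnion_finset_le _ _
    _ ≤ ∑ j ∈ Finset.range (⌊T / h⌋₊ + 1), A / (ε / 3) ^ 2 / N := Finset.sum_le_sum hjb
    _ = _ := by
      rw [Finset.sum_const, Finset.card_range, nsmul_eq_mul]
      push_cast
      ring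

/-! ### Paths in the Skorokhod space -/

namespace SkorokhodPath

theorem mem_nbhd_of_forall_abs_sub_lt {x y : SkorokhodPath} {T : ℝ≥0} {ε : ℝ} (hε : 0 < ε)
    (h : ∀ t ≤ T, |y t - x t| < ε) : y ∈ x.nbhd T ε :=
  ⟨OrderIso.refl _, fun t ht => ⟨by simpa using hε, h t ht⟩⟩

/-- The identity is an admissible time change, so locally uniform convergence implies J1
convergence. This is the only direction the proof uses. -/
theorem tendsto_of_forall_eventually_abs_sub_lt {ι : Type*} {l : Filter ι} {y : ι → SkorokhodPath}
    {x : SkorokhodPath}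
    (h : ∀ T : ℝ≥0, ∀ ε > 0, ∀ᶠ i in l, ∀ t ≤ T, |y i t - x t| < ε) : Tendsto y l (𝓝 x) := by
  refine tendsto_nhds.2 fun U hU hx => ?_
  obtain ⟨T, ε, hε, hsub⟩ := hU x hx
  filter_upwards [h T ε hε] with i hi
  exact hsub (mem_nbhd_of_forall_abs_sub_lt hε hi)

/-- The path given by a continuous function. -/
def ofContinuous (x : ℝ≥0 → ℝ) (hx : Continuous x) : SkorokhodPath :=
  ⟨x, fun t => ⟨hx.continuousWithinAt, x t, hx.continuousWithinAt⟩⟩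

theorem eq_of_toFun_eq {x y : SkorokhodPath} (h : x.toFun = y.toFun) : x = y := by
  cases x; cases y; cases h; rfl

end SkorokhodPath

/-- Up to time `T` a path depends on finitely many coordinates. Continuity gives Borel measurability
of the random path without any description of the Borel sets of the Skorokhod space. -/
theorem continuous_rescaledPath (N : ℕ) : Continuous (rescaledPath N) := by
  refine continuous_iff_continuousAt.2 fun a => ?_
  refine SkorokhodPath.tendsto_of_forall_eventually_abs_sub_lt fun T ε hε => ?_
  have : ∀ᶠ b in 𝓝 a, ∀ n ∈ Finset.range (⌊(N : ℝ≥0) * T⌋₊ + 1), |b n - a n| < ε := by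
    rw [Filter.eventually_all_finset]
    intro n _
    have := (continuous_apply n).tendsto a
    exact this.eventually (Metric.ball_mem_nhds _ hε)
  filter_upwards [this] with b hb t ht
  refine hb _ ?_
  rw [Finset.mem_range, Nat.lt_succ_iff]
  exact Nat.floor_le_floor (by gcongr)

theorem measurable_rescaledPath_magnetization {N : ℕ} {Ω : Type*} [MeasurableSpace Ω]
    {σ : ℕ → Ω → SpinConfig N} (hσ : ∀ n, Measurable (σ n)) :
    Measurable fun ω => rescaledPath N fun n => magnetization (σ n ω) :=
  (continuous_rescaledPath N).measurable.comp
    (measurable_pi_lambda _ fun n => (measurable_of_finite magnetization).comp (hσ n))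

/-- The solutions of the equation, as a map from initial values to paths. -/
theorem InwardField.exists_flow {F : ℝ → ℝ} {K L : ℝ≥0} (hF : InwardField F K L) :
    ∃ Φ : ℝ → SkorokhodPath, Continuous Φ ∧ ∀ x ∈ Icc (-1 : ℝ) 1,
      Φ x 0 = x ∧ SolvesODE F (Φ x) ∧ ∀ t, Φ x t ∈ Icc (-1 : ℝ) 1 := by
  have h11 : (-1 : ℝ) ≤ 1 := by norm_num
  have hex : ∀ x : Icc (-1 : ℝ) 1, ∃ m : SkorokhodPath,
      m 0 = x ∧ SolvesODE F m ∧ ∀ t, m t ∈ Icc (-1 : ℝ) 1 := fun x => by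
    obtain ⟨m, h0, hm, hmem⟩ := hF.exists_solvesODE x.2
    exact ⟨SkorokhodPath.ofContinuous m hm.continuous, h0, hm, hmem⟩
  choose Ψ hΨ0 hΨ hΨm using hex
  -- Clamping the initial value makes the flow continuous on all of `ℝ`, so it can be composed with
  -- test functions.
  refine ⟨fun x => Ψ (projIcc (-1) 1 h11 x), ?_, fun x hx => ?_⟩
  · have : Continuous Ψ := by
      refine continuous_iff_continuousAt.2 fun x => ?_
      refine SkorokhodPath.tendsto_of_forall_eventually_abs_sub_lt fun T ε hε => ?_
      have hε' : 0 < ε / Real.exp (K * T) := by positivity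
      filter_upwards [Metric.ball_mem_nhds x hε'] with y hy t ht
      have hd : |(y : ℝ) - x| < ε / Real.exp (K * T) := hy
      have h1 := SolvesODE.abs_sub_le hF.lipschitz (hΨ y) (hΨ x) (hΨm y) (hΨm x) t
      rw [hΨ0, hΨ0] at h1
      refine h1.trans_lt ?_
      have ht' : (t : ℝ) ≤ T := ht
      calc |(y : ℝ) - x| * Real.exp (K * t) ≤ |(y : ℝ) - x| * Real.exp (K * T) := by gcongr
        _ < ε := (lt_div_iff₀ (Real.exp_pos _)).1 hd
    exact this.comp continuous_projIcc
  · have e := projIcc_of_mem h11 hx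
    refine ⟨?_, hΨ _, hΨm _⟩
    rw [hΨ0, e]

/-- A continuous function on the Skorokhod space is uniformly continuous, with respect to uniform
convergence on compact time intervals, at the points of a compact family of paths. -/
theorem exists_forall_close_abs_sub_lt {Φ : ℝ → SkorokhodPath} {S : Set ℝ} (hS : IsCompact S)
    {K : ℝ} (hΦ : ∀ x ∈ S, ∀ y ∈ S, ∀ t : ℝ≥0, |Φ x t - Φ y t| ≤ |x - y| * Real.exp (K * t))
    {f : SkorokhodPath → ℝ} (hf : Continuous f) {η : ℝ} (hη : 0 < η) :
    ∃ T : ℝ≥0, ∃ ε > 0, ∀ x ∈ S, ∀ y : SkorokhodPath,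
      (∀ t ≤ T, |y t - Φ x t| < ε) → |f y - f (Φ x)| < η := by
  by_contra hcon
  push Not at hcon
  have hn : ∀ n : ℕ, (0 : ℝ) < 1 / (n + 1) := fun n => by positivity
  -- Counterexamples with `T = n` and `ε = 1/(n+1)`: along a subsequence, `y` and `Φ x` converge to
  -- the same path, so continuity of `f` at that path is contradicted.
  choose x hxS y hclose hfar using fun n : ℕ => hcon n (1 / (n + 1)) (hn n)
  obtain ⟨z, hz, k, hk, hlim⟩ := hS.tendsto_subseq hxS
  have hd : Tendsto (fun n => |x (k n) - z|) atTop (𝓝 0) :=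
    (tendsto_zero_iff_abs_tendsto_zero _).1 (tendsto_sub_nhds_zero_iff.2 hlim)
  have hflow : ∀ T : ℝ≥0, ∀ ε > 0, ∀ᶠ n in atTop, ∀ t ≤ T, |Φ (x (k n)) t - Φ z t| < ε := by
    intro T ε hε
    have := hd.mul_const (Real.exp (|K| * T))
    rw [zero_mul] at this
    filter_upwards [this.eventually (gt_mem_nhds hε)] with n hn t ht
    have ht' : (t : ℝ) ≤ T := ht
    refine (hΦ _ (hxS _) _ hz t).trans_lt (lt_of_le_of_lt ?_ hn)
    gcongr
    exact le_abs_self K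
  have h1 : Tendsto (fun n => Φ (x (k n))) atTop (𝓝 (Φ z)) :=
    SkorokhodPath.tendsto_of_forall_eventually_abs_sub_lt hflow
  have h2 : Tendsto (fun n => y (k n)) atTop (𝓝 (Φ z)) := by
    refine SkorokhodPath.tendsto_of_forall_eventually_abs_sub_lt fun T ε hε => ?_
    have hsmall := (tendsto_one_div_add_atTop_nhds_zero_nat (𝕜 := ℝ)).eventually
      (gt_mem_nhds (half_pos hε))
    filter_upwards [hflow T (ε / 2) (half_pos hε), hk.tendsto_atTop.eventually hsmall,
      hk.tendsto_atTop.eventually (eventually_ge_atTop ⌈T⌉₊)] with n hn1 hn2 hn3 t ht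
    have hkT : T ≤ ((k n : ℕ) : ℝ≥0) := Nat.ceil_le.1 hn3
    have a1 := hclose (k n) t (ht.trans hkT)
    have a2 := hn1 t ht
    have e : y (k n) t - Φ z t = (y (k n) t - Φ (x (k n)) t) + (Φ (x (k n)) t - Φ z t) := by ring
    rw [e]
    refine (abs_add_le _ _).trans_lt ?_
    linarith
  have h3 := ((hf.tendsto _).comp h2).sub ((hf.tendsto _).comp h1)
  rw [sub_self] at h3
  have h4 := (tendsto_zero_iff_abs_tendsto_zero _).1 h3
  obtain ⟨n, hn⟩ := (h4.eventually (gt_mem_nhds hη)).exists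
  exact absurd (hfar (k n)) (not_le.2 hn)

/-! ### Convergence in distribution -/

theorem abs_integral_le_of_measureReal_le {Ω : Type*} [MeasurableSpace Ω] {P : Measure Ω}
    [IsProbabilityMeasure P] {Z : Ω → ℝ} (hZ : Measurable Z) {C η b : ℝ} (hC : ∀ ω, |Z ω| ≤ C)
    (hη : 0 ≤ η) (hb : P.real {ω | η ≤ |Z ω|} ≤ b) : |∫ ω, Z ω ∂P| ≤ η + C * b := by
  have hC0 : 0 ≤ C := by
    obtain ⟨ω⟩ := nonempty_of_isProbabilityMeasure P
    exact (abs_nonneg _).trans (hC ω)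
  have hS : MeasurableSet {ω | η ≤ |Z ω|} := measurableSet_le measurable_const hZ.abs
  have hint : Integrable (fun ω => {ω | η ≤ |Z ω|}.indicator (fun _ => C) ω) P :=
    (integrable_const C).indicator hS
  calc |∫ ω, Z ω ∂P| ≤ ∫ ω, |Z ω| ∂P := abs_integral_le_integral_abs
    _ ≤ ∫ ω, (η + {ω | η ≤ |Z ω|}.indicator (fun _ => C) ω) ∂P := by
        refine integral_mono_of_nonneg (ae_of_all _ fun _ => abs_nonneg _)
          ((integrable_const η).add hint) (ae_of_all _ fun ω => ?_)
        by_cases h : η ≤ |Z ω|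
        · have : ω ∈ {ω | η ≤ |Z ω|} := h
          simp only [indicator_of_mem this]
          linarith [hC ω]
        · have : ω ∉ {ω | η ≤ |Z ω|} := h
          simp only [indicator_of_notMem this]
          linarith
    _ = η + C * P.real {ω | η ≤ |Z ω|} := by
        rw [integral_add (integrable_const η) hint, integral_indicator hS, setIntegral_const,
          integral_const, probReal_univ, smul_eq_mul, smul_eq_mul, one_mul, mul_comm]
    _ ≤ η + C * b := by gcongr

/-- Portmanteau for closed sets. It places the limiting initial value in `[-1, 1]`, where solutions
are unique. -/
theorem ae_mem_of_tendstoInDistribution {Ω : ℕ → Type*} [∀ N, MeasurableSpace (Ω N)]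
    {P : ∀ N, Measure (Ω N)} [∀ N, IsProbabilityMeasure (P N)] {Ω' : Type*} [MeasurableSpace Ω']
    {Q : Measure Ω'} [IsProbabilityMeasure Q] {X : ∀ N, Ω N → ℝ} {Z : Ω' → ℝ} {S : Set ℝ}
    (hS : IsClosed S) (hX : ∀ N ω, X N ω ∈ S) (h : TendstoInDistribution X atTop Z P Q) :
    ∀ᵐ ω ∂Q, Z ω ∈ S := by
  have hle := ProbabilityMeasure.limsup_measure_closed_le_of_tendsto h.tendsto hS
  have h1 : ∀ N, (P N).map (X N) S = 1 := fun N => by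
    rw [Measure.map_apply_of_aemeasurable (h.forall_aemeasurable N) hS.measurableSet,
      show X N ⁻¹' S = univ from eq_univ_of_forall (hX N), measure_univ]
  simp only [ProbabilityMeasure.coe_mk, h1, limsup_const] at hle
  rw [Measure.map_apply_of_aemeasurable h.aemeasurable_limit hS.measurableSet] at hle
  exact (prob_compl_eq_zero_iff₀ (h.aemeasurable_limit.nullMeasurableSet_preimage
    hS.measurableSet)).2 (le_antisymm prob_le_one hle)

theorem tendstoInDistribution_rescaled_magnetization {p : ℕ} (hp : 1 ≤ p) {β : ℝ} (hβ : 0 ≤ β)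
    {Ω : ℕ → Type*} [∀ N, MeasurableSpace (Ω N)] {P : ∀ N, Measure (Ω N)}
    [∀ N, IsProbabilityMeasure (P N)] {σ : ∀ N, ℕ → Ω N → SpinConfig N} {Ω' : Type*}
    [MeasurableSpace Ω'] {Q : Measure Ω'} [IsProbabilityMeasure Q] {M : Ω' → SkorokhodPath}
    (hσ : ∀ N n, Measurable (σ N n))
    (hchain : ∀ N, p ≤ N → IsRandomBatchChain p β (P N) (σ N))
    (hM : ∀ᵐ ω ∂Q, SolvesODE (rbDrift p β) (M ω))
    (hinit : TendstoInDistribution (fun N ω => magnetization (σ N 0 ω)) atTop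
      (fun ω => M ω 0) P Q) :
    TendstoInDistribution
      (fun N ω => rescaledPath N (fun n => magnetization (σ N n ω))) atTop M P Q := by
  obtain ⟨K, L, hF⟩ := exists_inwardField_rbDrift p hp β
  obtain ⟨Φ, hΦc, hΦ⟩ := hF.exists_flow
  have hmem := ae_mem_of_tendstoInDistribution isClosed_Icc
    (fun N ω => magnetization_mem_Icc (σ N 0 ω)) hinit
  -- Uniqueness identifies the limit with the flow of its initial value; this also supplies the a.e.
  -- measurability of `M`, which is not assumed.
  have hMΦ : (fun ω => Φ (M ω 0)) =ᵐ[Q] M := by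
    filter_upwards [hM, hmem] with ω h1 h2
    obtain ⟨h0, hs, -⟩ := hΦ _ h2
    exact SkorokhodPath.eq_of_toFun_eq (SolvesODE.eq_of_inward hF h1 hs h2 h0)
  have hMm : AEMeasurable M Q :=
    (hΦc.measurable.comp_aemeasurable hinit.aemeasurable_limit).congr hMΦ
  have hXm := fun N => measurable_rescaledPath_magnetization (hσ N)
  have hm0 : ∀ N, Measurable fun ω => magnetization (σ N 0 ω) := fun N =>
    (measurable_of_finite magnetization).comp (hσ N 0)
  refine ⟨fun N => (hXm N).aemeasurable, hMm,
    ProbabilityMeasure.tendsto_iff_forall_integral_tendsto.2 fun f => ?_⟩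
  have hinit' := ProbabilityMeasure.tendsto_iff_forall_integral_tendsto.1 hinit.tendsto
    (f.compContinuous ⟨Φ, hΦc⟩)
  simp only [ProbabilityMeasure.coe_mk] at hinit' ⊢
  rw [integral_map hMm f.continuous.aestronglyMeasurable]
  rw [integral_map hinit.aemeasurable_limit
    (BoundedContinuousFunction.continuous _).aestronglyMeasurable] at hinit'
  have e1 : ∀ N, ∫ x, f x ∂((P N).map fun ω => rescaledPath N fun n => magnetization (σ N n ω))
      = ∫ ω, f (rescaledPath N fun n => magnetization (σ N n ω)) ∂P N := fun N =>
    integral_map (hXm N).aemeasurable f.continuous.aestronglyMeasurable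
  have e2 : ∀ N, ∫ x, f.compContinuous ⟨Φ, hΦc⟩ x
      ∂((P N).map fun ω => magnetization (σ N 0 ω))
      = ∫ ω, f (Φ (magnetization (σ N 0 ω))) ∂P N := fun N =>
    integral_map (hm0 N).aemeasurable (BoundedContinuousFunction.continuous _).aestronglyMeasurable
  simp only [e1]
  simp only [e2] at hinit'
  have e3 : ∫ ω, f (M ω) ∂Q = ∫ ω, f.compContinuous ⟨Φ, hΦc⟩ (M ω 0) ∂Q :=
    integral_congr_ae (hMΦ.mono fun ω h => (congrArg f h).symm)
  rw [e3]
  -- Both paths live on the same probability space: where they are close the integrands differ by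
  -- less than `η/2`, and elsewhere by at most `2‖f‖` on an event of probability at most `B/N`.
  have hdiff : Tendsto (fun N => ∫ ω, f (rescaledPath N fun n => magnetization (σ N n ω)) ∂P N
      - ∫ ω, f (Φ (magnetization (σ N 0 ω))) ∂P N) atTop (𝓝 0) := by
    rw [Metric.tendsto_atTop']
    intro η hη
    obtain ⟨T, ε, hε, hT⟩ := exists_forall_close_abs_sub_lt (K := K) isCompact_Icc
      (fun x hx y hy t => by
        have := SolvesODE.abs_sub_le hF.lipschitz (hΦ x hx).2.1 (hΦ y hy).2.1 (hΦ x hx).2.2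
          (hΦ y hy).2.2 t
        rwa [(hΦ x hx).1, (hΦ y hy).1] at this) f.continuous (half_pos hη)
    obtain ⟨B, hB⟩ := exists_measureReal_not_close_le hp hβ (φ := fun x => Φ x)
      (fun x hx => ⟨(hΦ x hx).1, (hΦ x hx).2.1⟩) T hε
    have hsmall : ∀ᶠ N : ℕ in atTop, 2 * ‖f‖ * (B / N) < η / 2 := by
      have := (tendsto_const_div_atTop_nhds_zero_nat B).const_mul (2 * ‖f‖)
      rw [mul_zero] at this
      exact this.eventually (gt_mem_nhds (half_pos hη))
    obtain ⟨N₀, hN₀⟩ := ((hB.and hsmall).and (eventually_ge_atTop p)).exists_forall_of_atTop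
    refine ⟨N₀, fun N hN => ?_⟩
    obtain ⟨⟨h1, h2⟩, h3⟩ := hN₀ N hN.le
    have hfX : Measurable fun ω => f (rescaledPath N fun n => magnetization (σ N n ω)) :=
      f.continuous.measurable.comp (hXm N)
    have hfΦ : Measurable fun ω => f (Φ (magnetization (σ N 0 ω))) :=
      (f.continuous.comp hΦc).measurable.comp (hm0 N)
    have hbd : ∀ y, |f y| ≤ ‖f‖ := fun y => f.norm_coe_le_norm y
    rw [Real.dist_eq, sub_zero, ← integral_sub
      (Integrable.of_bound hfX.aestronglyMeasurable ‖f‖ (ae_of_all _ fun ω => hbd _))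
      (Integrable.of_bound hfΦ.aestronglyMeasurable ‖f‖ (ae_of_all _ fun ω => hbd _))]
    have := abs_integral_le_of_measureReal_le (P := P N) (hfX.sub hfΦ) (C := 2 * ‖f‖) (η := η / 2)
      (b := B / N) (fun ω => ?_) (half_pos hη).le ?_
    · refine this.trans_lt ?_
      linarith
    · refine (abs_sub _ _).trans ?_
      linarith [hbd (rescaledPath N fun n => magnetization (σ N n ω)),
        hbd (Φ (magnetization (σ N 0 ω)))]
    · refine (measureReal_mono fun ω hω hclose => ?_).trans (h1 (P N) (σ N) (hσ N) (hchain N h3))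
      exact absurd (hT _ (magnetization_mem_Icc (σ N 0 ω))
        (rescaledPath N fun n => magnetization (σ N n ω)) hclose) (not_lt.2 hω)
  have := hdiff.add hinit'
  rw [zero_add] at this
  exact this.congr fun N => sub_add_cancel _ _

/-! ### The phase diagram -/

theorem exists_hasDerivAt_rbDrift_three (β : ℝ) :
    ∃ d, HasDerivAt (rbDrift 3 β) d 0 ∧ d < 0 ∧
      ∀ m ∈ Icc (-1 : ℝ) 1, rbDrift 3 β m = 0 → m = 0 := by
  have he := Real.exp_pos (-(4 * β / 3))
  set e := Real.exp (-(4 * β / 3)) with hedef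
  have hf : rbDrift 3 β = fun m => m * (-(1 + 3 * e) / 2 + m ^ 2 * (1 - e) / 2) :=
    funext (rbDrift_three β)
  refine ⟨-(1 + 3 * e) / 2, ?_, by linarith, fun m hm h => ?_⟩
  · rw [hf]
    refine ((hasDerivAt_id (0 : ℝ)).mul (((((hasDerivAt_id (0 : ℝ)).pow 2).mul_const
      (1 - e)).div_const 2).const_add (-(1 + 3 * e) / 2))).congr_deriv ?_
    simp
  · rw [hf] at h
    refine (mul_eq_zero.1 h).resolve_right fun h' => ?_
    have h1 : m ^ 2 ≤ 1 := by nlinarith [hm.1, hm.2]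
    -- A zero of the bracket would satisfy `m² = 1 + 3e + e m² > 1`.
    nlinarith [mul_nonneg (sub_nonneg.2 h1) he.le, sq_nonneg m]

end

theorem mainTheorem1 :
    -- limit of the time-rescaled magnetization, for all batch sizes
    (∀ p : ℕ, 2 ≤ p → ∀ β : ℝ, 0 < β →
      (∀ x ∈ Icc (-1 : ℝ) 1, ∃ m : SkorokhodPath,
        (m 0 = x ∧ SolvesODE (rbDrift p β) m ∧ ∀ t, m t ∈ Icc (-1 : ℝ) 1) ∧
        ∀ m' : ℝ≥0 → ℝ, m' 0 = x → SolvesODE (rbDrift p β) m' → m' = m) ∧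
      (∀ (Ω : ℕ → Type*) (_ : ∀ N, MeasurableSpace (Ω N)) (P : ∀ N, Measure (Ω N))
          (_ : ∀ N, IsProbabilityMeasure (P N)) (σ : ∀ N, ℕ → Ω N → SpinConfig N)
          (Ω' : Type*) (_ : MeasurableSpace Ω') (Q : Measure Ω') (_ : IsProbabilityMeasure Q)
          (M : Ω' → SkorokhodPath),
        (∀ N n, Measurable (σ N n)) →
        (∀ N, p ≤ N → IsRandomBatchChain p β (P N) (σ N)) →
        (∀ᵐ ω ∂Q, SolvesODE (rbDrift p β) (M ω)) →
        TendstoInDistribution (fun N ω => magnetization (σ N 0 ω)) atTop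
          (fun ω => M ω 0) P Q →
        TendstoInDistribution
          (fun N ω => rescaledPath N (fun n => magnetization (σ N n ω))) atTop M P Q) ∧
      IsEquilibrium (rbDrift p β) 0) ∧
    -- batch sizes two and three
    (∀ p : ℕ, p = 2 ∨ p = 3 → ∀ β : ℝ, 0 < β →
      (∀ m ∈ Icc (-1 : ℝ) 1, IsEquilibrium (rbDrift p β) m ↔ m = 0) ∧
      deriv (rbDrift p β) 0 < 0 ∧
      IsLinearlyStable (rbDrift p β) 0 ∧ IsAsymptoticallyStable (rbDrift p β) 0) ∧
    -- the phase transition for larger batches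
    (∃ βc : ℕ → ℝ,
      (∀ p : ℕ, 4 ≤ p → 0 < βc p ∧ ∀ β : ℝ, 0 < β →
        (β ≤ βc p → IsLinearlyStable (rbDrift p β) 0) ∧
        (β < βc p → deriv (rbDrift p β) 0 < 0 ∧ IsAsymptoticallyStable (rbDrift p β) 0) ∧
        (βc p < β → 0 < deriv (rbDrift p β) 0 ∧ IsUnstable (rbDrift p β) 0)) ∧
      (fun p : ℕ => βc p - (1 + Real.sqrt (2 / ((p : ℝ) * Real.pi))))
        =o[atTop] (fun p : ℕ => 1 / Real.sqrt (p : ℝ))) := by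
  refine ⟨fun p hp β hβ => ⟨fun x hx => ?_, ?_, rbDrift_zero p (by omega) β⟩, ?_, ?_⟩
  · obtain ⟨K, L, hF⟩ := exists_inwardField_rbDrift p (by omega) β
    obtain ⟨m, h0, hm, hmem⟩ := hF.exists_solvesODE hx
    refine ⟨SkorokhodPath.ofContinuous m hm.continuous, ⟨h0, hm, hmem⟩, fun m' h0' hm' => ?_⟩
    exact SolvesODE.eq_of_inward hF hm hm' (h0.symm ▸ hx : m 0 ∈ Icc (-1 : ℝ) 1)
      (h0'.trans h0.symm)
  · intro Ω _ P _ σ Ω' _ Q _ M hσ hchain hM hinit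
    exact tendstoInDistribution_rescaled_magnetization (by omega) hβ.le hσ hchain hM hinit
  · rintro p hp β -
    obtain ⟨d, hd, hd0, heq⟩ : ∃ d, HasDerivAt (rbDrift p β) d 0 ∧ d < 0 ∧
        ∀ m ∈ Icc (-1 : ℝ) 1, rbDrift p β m = 0 → m = 0 := by
      rcases hp with rfl | rfl
      · have he := Real.exp_pos (-β)
        refine ⟨-2 * Real.exp (-β), ?_, by linarith, fun m _ h => ?_⟩
        · rw [show rbDrift 2 β = fun m => -2 * m * Real.exp (-β) from funext (rbDrift_two β)]
          simpa using ((hasDerivAt_id (0 : ℝ)).const_mul (-2)).mul_const (Real.exp (-β))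
        · rw [rbDrift_two] at h
          simpa [he.ne'] using h
      · exact exists_hasDerivAt_rbDrift_three β
    have h0 : rbDrift p β 0 = 0 := rbDrift_zero p (by omega) β
    exact ⟨fun m hm => ⟨heq m hm, fun h => by rw [h]; exact h0⟩, by rwa [hd.deriv],
      ⟨h0, hd.differentiableAt, by rw [hd.deriv]; exact hd0.le⟩,
      isAsymptoticallyStable_of_hasDerivAt_neg hd h0 hd0⟩
  · choose b hb hb0 using exists_rbSlope_eq_zero
    set βc : ℕ → ℝ := fun p => if h : 3 ≤ p - 1 then b (p - 1) h else 0 with hβc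
    have hroot : ∀ n (hn : 3 ≤ n), βc (n + 1) = b n hn := fun n hn => dif_pos hn
    refine ⟨βc, fun p hp => ?_,
      isLittleO_rbSlope_root fun n hn => by rw [hroot n hn]; exact hb0 n hn⟩
    obtain ⟨n, rfl⟩ : ∃ n, p = n + 1 := ⟨p - 1, by omega⟩
    have hn : 3 ≤ n := by omega
    have hmono := rbSlope_strictMono n (by omega)
    have hc : rbSlope n (βc (n + 1)) = 0 := by rw [hroot n hn]; exact hb0 n hn
    refine ⟨by rw [hroot n hn]; exact hb n hn, fun β _ => ?_⟩
    have hd := hasDerivAt_rbDrift_zero n β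
    have h0 : rbDrift (n + 1) β 0 = 0 := rbDrift_zero (n + 1) (by omega) β
    have h2 : (0 : ℝ) < 2 / 2 ^ n := by positivity
    refine ⟨fun h => ⟨h0, hd.differentiableAt, ?_⟩, fun h => ?_, fun h => ?_⟩
    · rw [hd.deriv]
      exact mul_nonpos_of_nonneg_of_nonpos h2.le (hc ▸ hmono.monotone h)
    · have hneg := mul_neg_of_pos_of_neg h2 (hc ▸ hmono h)
      exact ⟨by rwa [hd.deriv], isAsymptoticallyStable_of_hasDerivAt_neg hd h0 hneg⟩
    · have hpos := mul_pos h2 (hc ▸ hmono h)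
      obtain ⟨K, L, hF⟩ := exists_inwardField_rbDrift (n + 1) (by omega) β
      exact ⟨by rwa [hd.deriv], isUnstable_of_hasDerivAt_pos hF hd h0 hpos⟩
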